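/- Let $n\ge 0$ and let $A_n=\{1<2<\dots<n\}$. A *timed word* of length $l(w)=r\ge 0$ in $A_n$ is a function $w:[0,r)\to A_n$ for which there are finitely many points $0=r_0<r_1<\dots<r_k=r$ such that $w$ is constant on each $[r_{i-1},r_i)$. Timed words form a monoid $A_n^\dagger$ under concatenation: $vw$ has length $l(v)+l(w)$, with $(vw)(t)=v(t)$ for $t<l(v)$ and $(vw)(t)=w(t-l(v))$ for $t\ge l(v)$. A *timed row* is a weakly increasing timed word. Every timed word $w$ has a unique *row decomposition* $w=u_lu_{l-1}\cdots u_1$, in which each $u_i$ is a non-empty timed row and $u_iu_{i-1}$ is not a row for $2\le i\le l$ (with $l=0$ for the empty word). For timed rows $u,v$ write $u\lhd v$ if $l(u)\ge l(v)$ and $u(t)<v(t)$ for all $0\le t<l(v)$. A *timed tableau* is a timed word whose row decomposition satisfies $u_1\lhd u_2\lhd\dots\lhd u_l$. *Timed Knuth equivalence* is the congruence $\equiv$ on the monoid $A_n^\dagger$ generated by the following relations, for all timed rows $x,y,z$ such that $xyz$ is a timed row: $$xzy\equiv zxy\quad\text{if } l(z)=l(y)>0\text{ and }\lim_{t\to l(y)^-}y(t)<z(0),$$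 $$yxz\equiv yzx\quad\text{if } l(x)=l(y)>0\text{ and }\lim_{t\to l(x)^-}x(t)<y(0).$$ **Theorem.** Every timed Knuth equivalence class in $A_n^\dagger$ contains exactly one timed tableau. -/

import Mathlib

open Filter Topology

/-- A timed word of length `r = length` in the linearly ordered alphabet with `n` letters
(modelled by `Fin n`): a function `[0, r) → Fin n` for which there are transition points
`0 = r₀ < r₁ < ⋯ < r_k = r` such that the function is constant on each `[r_i, r_{i+1})`. -/
structure TimedWord (n : ℕ) where
  length : ℝ
  toFun : Set.Ico (0 : ℝ) length → Fin n
  piecewise : ∃ (k : ℕ) (r : ℕ → ℝ), r 0 = 0 ∧ r k = length ∧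
    (∀ i < k, r i < r (i + 1)) ∧
    ∀ i < k, ∀ s t : Set.Ico (0 : ℝ) length,
      (s : ℝ) ∈ Set.Ico (r i) (r (i + 1)) → (t : ℝ) ∈ Set.Ico (r i) (r (i + 1)) →
        toFun s = toFun t

namespace TimedWord

variable {n : ℕ}

theorem ext_val {v w : TimedWord n} (hl : v.length = w.length)
    (hf : ∀ (t : ℝ) (hv : t ∈ Set.Ico (0 : ℝ) v.length) (hw : t ∈ Set.Ico (0 : ℝ) w.length),
      v.toFun ⟨t, hv⟩ = w.toFun ⟨t, hw⟩) : v = w := by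
  obtain ⟨l, f, hp⟩ := v
  obtain ⟨l', f', hp'⟩ := w
  obtain rfl : l = l' := hl
  obtain rfl : f = f' := funext fun x => hf x.1 x.2 x.2
  rfl

theorem length_nonneg (w : TimedWord n) : 0 ≤ w.length := by
  obtain ⟨k, r, h0, hk, hlt, -⟩ := w.piecewise
  have h : ∀ i ≤ k, 0 ≤ r i := by
    intro i
    induction i with
    | zero => intro _; exact h0.ge
    | succ i ih => intro hi; exact (ih (by omega)).trans (hlt i (by omega)).le
  exact hk ▸ h k le_rfl

/-- The empty word, of length zero. -/
def empty (n : ℕ) : TimedWord n where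
  length := 0
  toFun x := absurd (lt_of_le_of_lt x.2.1 x.2.2) (lt_irrefl _)
  piecewise := ⟨0, fun _ => 0, rfl, rfl, by simp, by simp⟩

/-- The underlying function of the concatenation `v w`: first `v`, then `w` shifted by `l(v)`. -/
noncomputable def concatFun (v w : TimedWord n) (x : Set.Ico (0 : ℝ) (v.length + w.length)) :
    Fin n :=
  if h : (x : ℝ) < v.length then v.toFun ⟨x, x.2.1, h⟩
  else w.toFun ⟨x - v.length, sub_nonneg.2 (not_lt.1 h), sub_lt_iff_lt_add'.2 x.2.2⟩

/-- Concatenation of timed words. -/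
noncomputable def concat (v w : TimedWord n) : TimedWord n where
  length := v.length + w.length
  toFun := concatFun v w
  piecewise := by
    obtain ⟨k, r, h0, hk, hlt, hc⟩ := v.piecewise
    obtain ⟨k', r', h0', hk', hlt', hc'⟩ := w.piecewise
    have hle : ∀ j, ∀ i ≤ j, j ≤ k → r i ≤ r j := by
      intro j
      induction j with
      | zero => intro i hi _; rw [Nat.le_zero.1 hi]
      | succ j ih =>
        intro i hi hj
        rcases Nat.lt_or_ge i (j + 1) with h | h
        · exact (ih i (by omega) (by omega)).trans (hlt j (by omega)).le
        · rw [le_antisymm hi h]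
    have hnn : ∀ i ≤ k', 0 ≤ r' i := by
      intro i
      induction i with
      | zero => intro _; exact h0'.ge
      | succ i ih => intro hi; exact (ih (by omega)).trans (hlt' i (by omega)).le
    have hr : ∀ i, k ≤ i →
        (if i ≤ k then r i else v.length + r' (i - k)) = v.length + r' (i - k) := by
      intro i hi
      rcases hi.eq_or_lt with rfl | h
      · simp [hk, h0']
      · simp [not_le.2 h]
    refine ⟨k + k', fun i => if i ≤ k then r i else v.length + r' (i - k), ?_, ?_, ?_, ?_⟩
    · simp [h0]
    · show (if k + k' ≤ k then r (k + k') else v.length + r' (k + k' - k)) = _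
      rw [hr _ (by omega), Nat.add_sub_cancel_left, hk']
    · intro i hi
      show (if i ≤ k then r i else v.length + r' (i - k)) <
        (if i + 1 ≤ k then r (i + 1) else v.length + r' (i + 1 - k))
      rcases Nat.lt_or_ge i k with h | h
      · rw [if_pos h.le, if_pos (by omega)]
        exact hlt i h
      · rw [hr _ h, hr _ (by omega), Nat.sub_add_comm h]
        have := hlt' (i - k) (by omega)
        linarith
    · intro i hi s t hs ht
      simp only [Set.mem_Ico] at hs ht
      rcases Nat.lt_or_ge i k with h | h
      · rw [if_pos h.le, if_pos (show i + 1 ≤ k by omega)] at hs ht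
        have hb := hle k (i + 1) (by omega) le_rfl
        rw [hk] at hb
        have hs' : (s : ℝ) < v.length := by linarith [hs.2]
        have ht' : (t : ℝ) < v.length := by linarith [ht.2]
        simp only [concatFun, hs', ht', dif_pos]
        exact hc i h _ _ hs ht
      · rw [hr _ h, hr _ (show k ≤ i + 1 by omega), Nat.sub_add_comm h] at hs ht
        have hb := hnn (i - k) (by omega)
        have hs' : ¬ (s : ℝ) < v.length := by linarith [hs.1]
        have ht' : ¬ (t : ℝ) < v.length := by linarith [ht.1]
        simp only [concatFun, hs', ht', dif_neg, not_false_eq_true]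
        refine hc' (i - k) (by omega) _ _ ⟨?_, ?_⟩ ⟨?_, ?_⟩ <;> simp only <;>
          linarith [hs.1, hs.2, ht.1, ht.2]

/-- The monoid of timed words in the alphabet with `n` letters, under concatenation. -/
noncomputable instance instMonoid : Monoid (TimedWord n) where
  mul := concat
  one := empty n
  mul_assoc a b c := by
    refine ext_val (add_assoc _ _ _) fun t hv hw => ?_
    have hb := b.length_nonneg
    show concatFun (concat a b) c ⟨t, hv⟩ = concatFun a (concat b c) ⟨t, hw⟩
    have hl : (concat a b).length = a.length + b.length := rfl
    by_cases h1 : t < a.length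
    · have h2 : t < a.length + b.length := by linarith
      have e : (concat a b).toFun = concatFun a b := rfl
      simp [concatFun, hl, e, h1, h2]
    · have e : (concat a b).toFun = concatFun a b := rfl
      have e' : (concat b c).toFun = concatFun b c := rfl
      by_cases h2 : t < a.length + b.length
      · have h3 : t - a.length < b.length := by linarith
        simp [concatFun, hl, e, e', h1, h2, h3]
      · have h3 : ¬ t - a.length < b.length := by linarith
        simp [concatFun, hl, e', h1, h2, h3, sub_sub]
  one_mul a := by
    refine ext_val (zero_add _) fun t hv hw => ?_
    show concatFun (empty n) a ⟨t, hv⟩ = _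
    have h : ¬ t < (empty n).length := not_lt.2 hw.1
    have h0 : (empty n).length = 0 := rfl
    simp only [concatFun, h, dif_neg, not_false_eq_true]
    congr 2
    rw [h0, sub_zero]
  mul_one a := by
    refine ext_val (add_zero _) fun t hv hw => ?_
    show concatFun a (empty n) ⟨t, hv⟩ = _
    simp [concatFun, hw.2]

/-- A timed row is a weakly increasing timed word. -/
def IsRow (w : TimedWord n) : Prop := Monotone w.toFun

/-- `u.DominatedBy v` is `u ◁ v`: `l(u) ≥ l(v)`, and `u(t) < v(t)` for all `0 ≤ t < l(v)`. -/
def DominatedBy (u v : TimedWord n) : Prop :=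
  v.length ≤ u.length ∧
    ∀ (t : ℝ) (hu : t ∈ Set.Ico (0 : ℝ) u.length) (hv : t ∈ Set.Ico (0 : ℝ) v.length),
      u.toFun ⟨t, hu⟩ < v.toFun ⟨t, hv⟩

/-- `L = [u_l, …, u_1]` is the row decomposition of `w`: `w = u_l ⋯ u_1`, every `u_i` is a
timed row, and `u_i u_{i-1}` is not a row. (Two or more such rows are automatically non-empty;
requiring it throughout makes `[]` the only decomposition of the empty word.) -/
def IsRowDecomposition (w : TimedWord n) (L : List (TimedWord n)) : Prop :=
  L.prod = w ∧ (∀ u ∈ L, u.IsRow ∧ u ≠ 1) ∧ L.IsChain fun u u' => ¬ (u * u').IsRow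

/-- A timed tableau is a timed word whose row decomposition `u_l ⋯ u_1` satisfies
`u_1 ◁ ⋯ ◁ u_l`. -/
def IsTableau (w : TimedWord n) : Prop :=
  ∃ L : List (TimedWord n), w.IsRowDecomposition L ∧ L.IsChain fun u u' => u'.DominatedBy u

/-- The left limit of `w(t)` at `t = l(w)` is the letter `a` (in the discrete topology). -/
def HasEndLimit (w : TimedWord n) (a : Fin n) : Prop :=
  Tendsto w.toFun (comap Subtype.val (𝓝[<] w.length)) (𝓝 a)

/-- The timed Knuth relations, for timed rows `x`, `y`, `z` such that `xyz` is a timed row. The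
side conditions compare the left limit of one row at its end with the initial letter of another,
so they presuppose that these two rows (of equal length) are non-empty; if both are empty, then
the two sides of the relation are the same word. -/
inductive KnuthRelation : TimedWord n → TimedWord n → Prop
  | kappa₁ (x y z : TimedWord n) (hx : x.IsRow) (hy : y.IsRow) (hz : z.IsRow)
      (hxyz : (x * y * z).IsRow) (hl : z.length = y.length) (hpos : 0 < z.length)
      (a : Fin n) (ha : y.HasEndLimit a) (hlt : a < z.toFun ⟨0, le_rfl, hpos⟩) :
      KnuthRelation (x * z * y) (z * x * y)
  | kappa₂ (x y z : TimedWord n) (hx : x.IsRow) (hy : y.IsRow) (hz : z.IsRow)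
      (hxyz : (x * y * z).IsRow) (hl : x.length = y.length) (hpos : 0 < y.length)
      (a : Fin n) (ha : x.HasEndLimit a) (hlt : a < y.toFun ⟨0, le_rfl, hpos⟩) :
      KnuthRelation (y * x * z) (y * z * x)

/-- Timed Knuth equivalence: the congruence on the monoid of timed words generated by the timed
Knuth relations. -/
noncomputable def knuthCon (n : ℕ) : Con (TimedWord n) := conGen KnuthRelation

/-- The timed plactic monoid; its elements are the timed Knuth equivalence classes. -/
abbrev Plactic (n : ℕ) : Type := (knuthCon n).Quotient

end TimedWord

/-! Uniqueness rests on a timed form of Greene's theorem. For a word `w`, let `chainMax k m w` be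
the greatest total length of `k` disjoint weakly increasing subwords with letters below `m`. This
number is computed letter by letter: a word acts on functions of the state, where the state records
the last letters of the `k` chains, and the functions are antitone and symmetric (`Good`). The
action is additive in the duration of a letter (`opA_add`), so it extends to all timed words through
`lift`.

The first Knuth relation is an identity between these operators (`opL_comm`), obtained by exchanging
tails of chains. The second is the first for the reversed word over the dual alphabet, and the
pairing `pair` transports it back (`pair_opL_comm`). Hence `chainMax` is constant on Knuth classes.
On a tableau with rows `p 0, p 1, …` it equals the total length of the letters below `m` in the
lowest `k` rows (`chainMax_downProd`): these rows are themselves chains, and conversely a chain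
meets each strictly decreasing column at most once. Differences in `k` recover every row, so
equivalent tableaux coincide (`eq_of_isTableau_of_knuthCon`).

Existence is timed row insertion. A letter `a` of duration `s` enters a row after its letters up to
`a` and displaces the next stretch of length at most `s`; this is a composite of the two Knuth
relations (`knuthCon_insLetter`). Displaced words go to the next row, and domination between
consecutive rows is kept (`insWord_bumpWord_le`). Displaced letters exceed the inserted ones, so
nothing is left after `n` rows. -/

open scoped NNReal ENNReal

/-! ### Timed words as products of constant words. -/

namespace TimedWord

variable {n : ℕ}

/-- The letter of `w` at time `t` as a natural number, with the value `0` outside the domain. -/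
noncomputable def val (w : TimedWord n) (t : ℝ) : ℕ :=
  if h : t ∈ Set.Ico (0 : ℝ) w.length then (w.toFun ⟨t, h⟩ : ℕ) else 0

theorem val_eq {w : TimedWord n} {t : ℝ} (h : t ∈ Set.Ico (0 : ℝ) w.length) :
    w.val t = w.toFun ⟨t, h⟩ := dif_pos h

theorem val_of_notMem {w : TimedWord n} {t : ℝ} (h : t ∉ Set.Ico (0 : ℝ) w.length) :
    w.val t = 0 := dif_neg h

theorem ext_of_val {v w : TimedWord n} (hl : v.length = w.length)
    (hf : ∀ t, 0 ≤ t → t < w.length → v.val t = w.val t) : v = w := by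
  refine ext_val hl fun t hv hw => Fin.ext ?_
  rw [← val_eq hv, ← val_eq hw, hf t hw.1 hw.2]

@[simp] theorem length_mul (v w : TimedWord n) : (v * w).length = v.length + w.length := rfl

@[simp] theorem length_one : (1 : TimedWord n).length = 0 := rfl

theorem val_mul (v w : TimedWord n) (t : ℝ) :
    (v * w).val t = if t < v.length then v.val t else w.val (t - v.length) := by
  have hv0 := v.length_nonneg
  have hw0 := w.length_nonneg
  by_cases h : t ∈ Set.Ico (0 : ℝ) (v * w).length
  · rw [val_eq h]
    have h' : t < v.length + w.length := h.2
    change ((concatFun v w ⟨t, h⟩ : Fin n) : ℕ) = _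
    unfold concatFun
    by_cases hv : t < v.length
    · rw [dif_pos hv, if_pos hv, val_eq ⟨h.1, hv⟩]
    · rw [dif_neg hv, if_neg hv,
        val_eq ⟨sub_nonneg.2 (not_lt.1 hv), sub_lt_iff_lt_add'.2 h'⟩]
  · rw [val_of_notMem h]
    simp only [Set.mem_Ico, length_mul, not_and, not_lt] at h
    split_ifs with hv
    · rw [val_of_notMem]
      rintro ⟨h0, -⟩
      linarith [h h0]
    · rw [val_of_notMem]
      rintro ⟨h0, h1⟩
      have := h (by linarith)
      linarith

theorem isRow_iff {w : TimedWord n} :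
    w.IsRow ↔ ∀ s t, 0 ≤ s → s ≤ t → t < w.length → w.val s ≤ w.val t := by
  constructor
  · intro h s t hs hst ht
    rw [val_eq ⟨hs, hst.trans_lt ht⟩, val_eq ⟨hs.trans hst, ht⟩]
    exact h (show (⟨s, _⟩ : Set.Ico (0 : ℝ) w.length) ≤ ⟨t, _⟩ from hst)
  · rintro h ⟨s, hs⟩ ⟨t, ht⟩ hst
    have := h s t hs.1 hst ht.2
    rwa [val_eq hs, val_eq ht] at this

theorem eq_one_of_length_eq_zero {w : TimedWord n} (h : w.length = 0) : w = 1 :=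
  ext_of_val h fun _ h0 h1 => absurd (h0.trans_lt h1) (lt_irrefl _)

theorem eq_one_of_length_nonpos {w : TimedWord n} (h : w.length ≤ 0) : w = 1 :=
  eq_one_of_length_eq_zero (h.antisymm w.length_nonneg)

theorem length_pos {w : TimedWord n} (h : w ≠ 1) : 0 < w.length := by
  by_contra h'
  exact h (eq_one_of_length_nonpos (not_lt.1 h'))

theorem mul_left_cancel_word {u v w : TimedWord n} (h : u * v = u * w) : v = w := by
  have hl : v.length = w.length := by
    have := congrArg length h
    simpa using this
  refine ext_of_val hl fun t h0 h1 => ?_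
  have := congrArg (fun x => val x (t + u.length)) h
  simp only [val_mul] at this
  rw [if_neg (by linarith), if_neg (by linarith)] at this
  simpa using this

theorem isRow_of_mul {u v : TimedWord n} (h : (u * v).IsRow) :
    u.IsRow ∧ v.IsRow ∧
      ∀ s t, 0 ≤ s → s < u.length → 0 ≤ t → t < v.length → u.val s ≤ v.val t := by
  have hu0 := u.length_nonneg
  have hv0 := v.length_nonneg
  rw [isRow_iff] at h
  refine ⟨isRow_iff.2 fun s t hs hst ht => ?_, isRow_iff.2 fun s t hs hst ht => ?_,
    fun s t hs hs' ht ht' => ?_⟩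
  · have := h s t hs hst (by rw [length_mul]; linarith)
    rwa [val_mul, val_mul, if_pos (by linarith), if_pos (by linarith)] at this
  · have := h (s + u.length) (t + u.length) (by linarith) (by linarith)
      (by rw [length_mul]; linarith)
    rwa [val_mul, val_mul, if_neg (by linarith), if_neg (by linarith), add_sub_cancel_right,
      add_sub_cancel_right] at this
  · have := h s (t + u.length) (by linarith) (by linarith) (by rw [length_mul]; linarith)
    rwa [val_mul, val_mul, if_pos (by linarith), if_neg (by linarith),
      add_sub_cancel_right] at this

theorem isRow_one : (1 : TimedWord n).IsRow :=
  isRow_iff.2 fun s t hs hst ht => by rw [length_one] at ht; linarith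

/-- The constant word of length `s` with letter `a`. -/
def seg (a : Fin n) (s : ℝ≥0) : TimedWord n where
  length := s
  toFun _ := a
  piecewise := by
    rcases eq_zero_or_pos s with h | h
    · exact ⟨0, fun _ => 0, rfl, by simp [h], by simp, by simp⟩
    · exact ⟨1, fun i => i * s, by simp, by simp, by simpa using h, by simp⟩

@[simp] theorem length_seg (a : Fin n) (s : ℝ≥0) : (seg a s).length = s := rfl

theorem val_seg {a : Fin n} {s : ℝ≥0} {t : ℝ} (h0 : 0 ≤ t) (h1 : t < s) :
    (seg a s).val t = a := val_eq (w := seg a s) ⟨h0, h1⟩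

@[simp] theorem seg_zero (a : Fin n) : seg a 0 = 1 := eq_one_of_length_eq_zero rfl

theorem seg_add (a : Fin n) (s t : ℝ≥0) : seg a (s + t) = seg a s * seg a t := by
  refine ext_of_val (by simp) fun x h0 h1 => ?_
  rw [length_mul, length_seg, length_seg] at h1
  rw [val_seg h0 (by simpa using h1), val_mul, length_seg]
  split_ifs with h
  · rw [val_seg h0 h]
  · rw [val_seg (by linarith) (by linarith)]

/-- The word spelled by a list of letters with durations. -/
noncomputable def spell (L : List (Fin n × ℝ≥0)) : TimedWord n := (L.map fun x => seg x.1 x.2).prod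

@[simp] theorem spell_nil : spell ([] : List (Fin n × ℝ≥0)) = 1 := rfl

@[simp] theorem spell_cons (x : Fin n × ℝ≥0) (L) : spell (x :: L) = seg x.1 x.2 * spell L := by
  simp [spell]

theorem spell_append (L L' : List (Fin n × ℝ≥0)) : spell (L ++ L') = spell L * spell L' := by
  simp [spell]

theorem exists_spell (w : TimedWord n) : ∃ L, spell L = w := by
  obtain ⟨k, r, h0, hk, hlt, hc⟩ := w.piecewise
  have hle : ∀ j, ∀ i ≤ j, j ≤ k → r i ≤ r j := by
    intro j
    induction j with
    | zero => intro i hi _; rw [Nat.le_zero.1 hi]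
    | succ j ih =>
      intro i hi hj
      rcases Nat.lt_or_ge i (j + 1) with h | h
      · exact (ih i (by omega) (by omega)).trans (hlt j (by omega)).le
      · rw [le_antisymm hi h]
  have key : ∀ j ≤ k, ∃ L : List (Fin n × ℝ≥0), (spell L).length = r j ∧
      ∀ t, 0 ≤ t → t < r j → (spell L).val t = w.val t := by
    intro j
    induction j with
    | zero =>
      intro _
      exact ⟨[], by simp [h0], fun t h1 h2 => absurd (h1.trans_lt h2) (by simp [h0])⟩
    | succ j ih =>
      intro hj
      obtain ⟨L, hL, hv⟩ := ih (by omega)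
      have hj0 : 0 ≤ r j := h0 ▸ hle j 0 (by omega) (by omega)
      have hjk : r (j + 1) ≤ w.length := hk ▸ hle k (j + 1) hj le_rfl
      have hjj := hlt j (by omega)
      have hs : ((r (j + 1) - r j).toNNReal : ℝ) = r (j + 1) - r j :=
        Real.coe_toNNReal _ (by linarith)
      refine ⟨L ++ [(w.toFun ⟨r j, hj0, hjj.trans_le hjk⟩, (r (j + 1) - r j).toNNReal)],
        ?_, fun t h1 h2 => ?_⟩
      · simp [spell_append, hL, hjj.le]
      · rw [spell_append, val_mul, hL]
        split_ifs with ht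
        · exact hv t h1 ht
        · push Not at ht
          rw [spell_cons, spell_nil, mul_one, val_seg (by linarith) (by rw [hs]; linarith),
            val_eq ⟨h1, h2.trans_le hjk⟩]
          congr 1
          exact hc j (by omega) _ _ ⟨le_rfl, hjj⟩ ⟨ht, h2⟩
  obtain ⟨L, hL, hv⟩ := key k le_rfl
  exact ⟨L, ext_of_val (hL.trans hk) fun t h1 h2 => hv t h1 (hk ▸ h2)⟩

/-- Letters of zero duration are discarded so that every listed letter really occurs in the word;
only then can order properties of the word be read off the list. -/
theorem exists_spell_pos (w : TimedWord n) : ∃ L, spell L = w ∧ ∀ x ∈ L, 0 < x.2 := by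
  obtain ⟨L, rfl⟩ := exists_spell w
  induction L with
  | nil => exact ⟨[], rfl, by simp⟩
  | cons x L ih =>
    obtain ⟨L', h, h'⟩ := ih
    rcases eq_zero_or_pos x.2 with hx | hx
    · exact ⟨L', by simp [h, hx], h'⟩
    · exact ⟨x :: L', by simp [h], List.forall_mem_cons.2 ⟨hx, h'⟩⟩

theorem exists_val_eq {L : List (Fin n × ℝ≥0)} {x : Fin n × ℝ≥0} (hx : x ∈ L) (h : 0 < x.2) :
    ∃ t, 0 ≤ t ∧ t < (spell L).length ∧ (spell L).val t = x.1 := by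
  induction L with
  | nil => simp at hx
  | cons y L ih =>
    have hl := (spell L).length_nonneg
    rcases List.mem_cons.1 hx with rfl | hx
    · have h' : (0 : ℝ) < x.2 := h
      refine ⟨0, le_rfl, by simp; linarith, ?_⟩
      rw [spell_cons, val_mul, length_seg, if_pos h', val_seg le_rfl h']
    · obtain ⟨t, h0, h1, h2⟩ := ih hx
      have h3 : (0 : ℝ) ≤ y.2 := y.2.2
      refine ⟨t + y.2, by linarith, by simp; linarith, ?_⟩
      rw [spell_cons, val_mul, length_seg, if_neg (by linarith), add_sub_cancel_right, h2]

theorem exists_mem_of_val {L : List (Fin n × ℝ≥0)} {t : ℝ} (h0 : 0 ≤ t)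
    (h1 : t < (spell L).length) : ∃ x ∈ L, (spell L).val t = x.1 := by
  induction L generalizing t with
  | nil => exact absurd (h0.trans_lt h1) (lt_irrefl _)
  | cons y L ih =>
    rw [spell_cons, length_mul, length_seg] at h1
    rw [spell_cons, val_mul, length_seg]
    split_ifs with h
    · exact ⟨y, by simp, val_seg h0 h⟩
    · obtain ⟨x, hx, hx'⟩ := ih (t := t - y.2) (by linarith) (by linarith)
      exact ⟨x, by simp [hx], hx'⟩

theorem pairwise_of_isRow {L : List (Fin n × ℝ≥0)} (hL : ∀ x ∈ L, 0 < x.2)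
    (h : (spell L).IsRow) : L.Pairwise fun x y => x.1 ≤ y.1 := by
  induction L with
  | nil => exact List.Pairwise.nil
  | cons x L ih =>
    rw [spell_cons] at h
    obtain ⟨-, h2, h3⟩ := isRow_of_mul h
    refine List.Pairwise.cons (fun y hy => ?_) (ih (fun y hy => hL y (by simp [hy])) h2)
    obtain ⟨t, ht0, ht1, ht2⟩ := exists_val_eq hy (hL y (by simp [hy]))
    have hx : (0 : ℝ) < x.2 := hL x (by simp)
    have := h3 0 t le_rfl hx ht0 ht1
    rw [ht2, val_seg le_rfl hx] at this
    exact this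

theorem length_spell (L : List (Fin n × ℝ≥0)) :
    (spell L).length = ((L.map Prod.snd).sum : ℝ≥0) := by
  induction L with
  | nil => simp
  | cons x L ih => simp [ih]

section lift

variable {M : Type*} [Monoid M] (f : Fin n → ℝ≥0 → M)

/-- Timed words form the free product of `n` copies of the additive monoid of durations. Two
spellings of one word start with the same letter once zero durations are dropped; cancelling the
shorter of the two first durations shortens the lists. -/
theorem prod_map_eq_of_spell_eq (h0 : ∀ a, f a 0 = 1) (hf : ∀ a s t, f a (s + t) = f a s * f a t)
    (L L' : List (Fin n × ℝ≥0)) (h : spell L = spell L') :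
    (L.map fun x => f x.1 x.2).prod = (L'.map fun x => f x.1 x.2).prod := by
  induction hN : L.length + L'.length using Nat.strong_induction_on generalizing L L' with
  | _ N ih =>
  subst hN
  match L, L' with
  | [], [] => rfl
  | [], (b, t) :: K' =>
    have hl := congrArg length h
    simp only [spell_nil, spell_cons, length_mul, length_one, length_seg] at hl
    have ht : t = 0 := by
      have := (spell K').length_nonneg
      exact NNReal.eq (le_antisymm (by simp; linarith) t.2)
    subst ht
    have := ih _ (by simp) [] K' (by simpa using h) rfl
    simpa [h0] using this
  | (a, s) :: K, [] =>
    have hl := congrArg length h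
    simp only [spell_nil, spell_cons, length_mul, length_one, length_seg] at hl
    have hs : s = 0 := by
      have := (spell K).length_nonneg
      exact NNReal.eq (le_antisymm (by simp; linarith) s.2)
    subst hs
    have := ih _ (by simp) K [] (by simpa using h) rfl
    simpa [h0] using this
  | (a, s) :: K, (b, t) :: K' =>
    rcases eq_zero_or_pos s with hs | hs
    · subst hs
      have := ih _ (by simp) K ((b, t) :: K') (by simpa using h) rfl
      simpa [h0] using this
    rcases eq_zero_or_pos t with ht | ht
    · subst ht
      have := ih _ (by simp) ((a, s) :: K) K' (by simpa using h) rfl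
      simpa [h0] using this
    have hab : a = b := by
      have := congrArg (fun w => val w 0) h
      have hs' : (0 : ℝ) < s := hs
      have ht' : (0 : ℝ) < t := ht
      simp only [spell_cons, val_mul, length_seg, if_pos hs', if_pos ht',
        val_seg le_rfl hs', val_seg le_rfl ht'] at this
      exact Fin.ext this
    subst hab
    rcases le_total s t with hst | hst
    · obtain ⟨d, rfl⟩ := exists_add_of_le hst
      have e : spell K = spell ((a, d) :: K') := by
        simp only [spell_cons, seg_add, mul_assoc] at h
        simpa using mul_left_cancel_word h
      have := ih _ (by simp) _ _ e rfl
      simp [hf, this, mul_assoc]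
    · obtain ⟨d, rfl⟩ := exists_add_of_le hst
      have e : spell ((a, d) :: K) = spell K' := by
        simp only [spell_cons, seg_add, mul_assoc] at h
        simpa using mul_left_cancel_word h
      have := ih _ (by simp) _ _ e rfl
      simp [hf, ← this, mul_assoc]

/-- The homomorphism from timed words with prescribed, additive values on constant words. -/
noncomputable def lift (h0 : ∀ a, f a 0 = 1) (hf : ∀ a s t, f a (s + t) = f a s * f a t) :
    TimedWord n →* M where
  toFun w := ((exists_spell w).choose.map fun x => f x.1 x.2).prod
  map_one' := prod_map_eq_of_spell_eq f h0 hf _ [] (exists_spell 1).choose_spec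
  map_mul' u v := by
    rw [← List.prod_append, ← List.map_append]
    refine prod_map_eq_of_spell_eq f h0 hf _ _ ?_
    rw [(exists_spell (u * v)).choose_spec, spell_append, (exists_spell u).choose_spec,
      (exists_spell v).choose_spec]

theorem lift_spell (h0 : ∀ a, f a 0 = 1) (hf : ∀ a s t, f a (s + t) = f a s * f a t)
    (L : List (Fin n × ℝ≥0)) : lift f h0 hf (spell L) = (L.map fun x => f x.1 x.2).prod :=
  prod_map_eq_of_spell_eq f h0 hf _ _ (exists_spell _).choose_spec

end lift

end TimedWord

/-! ### Operators of letters and words on functions of the chain states. -/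

namespace ChainOp

open Function OrderDual

variable {α ι : Type*} [LinearOrder α] [DecidableEq ι]

/-- One step of the dynamic program for the greatest total weight of a family of weakly
increasing chains indexed by `ι`: `v i` is the last letter of chain `i`, and a letter `a` of
weight `s` may be left out or appended to one chain. -/
noncomputable def opA (a : α) (s : ℝ≥0) (F : (ι → α) → ℝ≥0∞) (v : ι → α) : ℝ≥0∞ :=
  F v ⊔ ⨆ i, ⨆ (_ : v i ≤ a), (s + F (update v i a))

/-- Functions of the state which are antitone and invariant under permuting the chains. -/
structure Good (F : (ι → α) → ℝ≥0∞) : Prop where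
  anti : Antitone F
  symm : ∀ (σ : Equiv.Perm ι) v, F (v ∘ σ) = F v

variable {F G : (ι → α) → ℝ≥0∞} {a b c : α} {s t r : ℝ≥0} {v : ι → α}

theorem Good.swap (hF : Good F) {i j : ι} (hij : i ≠ j) (v : ι → α) (a b : α) :
    F (update (update v i a) j b) = F (update (update v i b) j a) := by
  rw [← hF.symm (Equiv.swap i j)]
  congr 1
  funext x
  simp only [comp_apply]
  by_cases hxi : x = i
  · subst hxi
    simp [hij]
  by_cases hxj : x = j
  · subst hxj
    simp [hij]
  · rw [Equiv.swap_apply_of_ne_of_ne hxi hxj]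
    simp [hxi, hxj]

theorem opA_le {B : ℝ≥0∞} : opA a s F v ≤ B ↔
    F v ≤ B ∧ ∀ i, v i ≤ a → s + F (update v i a) ≤ B := by
  simp [opA]

theorem le_opA : F v ≤ opA a s F v := le_sup_left

theorem add_le_opA {i : ι} (h : v i ≤ a) : s + F (update v i a) ≤ opA a s F v :=
  (opA_le.1 le_rfl).2 i h

theorem opA_mono (h : F ≤ G) : opA a s F ≤ opA a s G := fun v =>
  opA_le.2 ⟨(h v).trans le_opA, fun _ hi => (add_le_add_right (h _) _).trans (add_le_opA hi)⟩

theorem Good.opA (hF : Good F) (a : α) (s : ℝ≥0) : Good (opA a s F) where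
  anti v w hvw := opA_le.2 ⟨(hF.anti hvw).trans le_opA, fun i hi =>
    (add_le_add_right (hF.anti (update_le_update_iff.2 ⟨le_rfl, fun j _ => hvw j⟩)) _).trans
      (add_le_opA ((hvw i).trans hi))⟩
  symm σ v := by
    have key : ∀ (σ : Equiv.Perm ι) v, ChainOp.opA a s F (v ∘ σ) ≤ ChainOp.opA a s F v := by
      intro σ v
      refine opA_le.2 ⟨(hF.symm σ v).le.trans le_opA, fun i hi => ?_⟩
      have : update (v ∘ σ) i a = update v (σ i) a ∘ σ := by
        funext x
        by_cases hx : x = i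
        · subst hx; simp
        · simp [hx]
      rw [this, hF.symm]
      exact add_le_opA hi
    refine (key σ v).antisymm ?_
    have := key σ⁻¹ (v ∘ σ)
    rwa [comp_assoc, show (σ : ι → ι) ∘ (σ⁻¹ : Equiv.Perm ι) = id from by
      funext x; simp, comp_id] at this

theorem Good.zero : Good (0 : (ι → α) → ℝ≥0∞) := ⟨fun _ _ _ => le_rfl, fun _ _ => rfl⟩

theorem le_update (h : v i ≤ a) : v ≤ update v i a := le_update_iff.2 ⟨h, fun _ _ => le_rfl⟩

theorem opA_zero (hF : Good F) (a : α) : opA a 0 F = F := by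
  refine le_antisymm (fun v => opA_le.2 ⟨le_rfl, fun i hi => ?_⟩) fun v => le_opA
  rw [ENNReal.coe_zero, zero_add]
  exact hF.anti (le_update hi)

/-- Finiteness of `r` allows it to be subtracted from the bound, which reduces the claim to
`opA_le`. -/
theorem add_opA_le {B r : ℝ≥0∞} (hr : r ≠ ∞) (h0 : r + F v ≤ B)
    (h : ∀ i, v i ≤ a → r + (s + F (update v i a)) ≤ B) : r + opA a s F v ≤ B := by
  have hB : r ≤ B := le_self_add.trans h0
  rw [← ENNReal.le_sub_iff_add_le_left hr hB, opA_le]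
  exact ⟨(ENNReal.le_sub_iff_add_le_left hr hB).2 h0,
    fun i hi => (ENNReal.le_sub_iff_add_le_left hr hB).2 (h i hi)⟩

/-- Splitting a letter gains nothing: if a chain takes one part, it may take the other too. Giving
the parts to two chains yields the same weight and a higher state, which is no better because `F` is
antitone. -/
theorem opA_add (hF : Good F) (a : α) (s t : ℝ≥0) :
    opA a (s + t) F = opA a s (opA a t F) := by
  refine le_antisymm (fun v => opA_le.2 ⟨le_opA.trans le_opA, fun i hi => ?_⟩) fun v =>
    opA_le.2 ⟨opA_le.2 ⟨le_opA, fun i hi => ?_⟩, fun i hi => add_opA_le (by simp) ?_ ?_⟩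
  · refine le_trans ?_ (add_le_opA hi)
    rw [ENNReal.coe_add, add_assoc]
    refine add_le_add_right ?_ _
    simpa using add_le_opA (F := F) (s := t) (i := i) (a := a) (v := update v i a) (by simp)
  · refine le_trans (add_le_add_left ?_ _) (add_le_opA hi)
    simp
  · refine le_trans (add_le_add_left ?_ _) (add_le_opA hi)
    simp
  · intro j hj
    rw [← add_assoc, ← ENNReal.coe_add]
    exact (add_le_add_right (hF.anti (le_update hj)) _).trans (add_le_opA hi)

/-- No chain can take `c` and then the smaller letter `a`, so every choice possible for `ca` is also
possible for `ac`. -/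
theorem opA_comm_le (hac : a < c) : opA c t (opA a s F) ≤ opA a s (opA c t F) := fun v => by
  refine opA_le.2 ⟨opA_mono (fun _ => le_opA) v, fun j hj => add_opA_le (by simp) ?_ ?_⟩
  · exact (add_le_opA hj).trans le_opA
  · intro i hi
    have hij : i ≠ j := by
      rintro rfl
      simp [hac.not_ge] at hi
    rw [update_of_ne hij] at hi
    rw [add_left_comm, update_comm hij.symm]
    exact (add_le_add_right (add_le_opA (by rwa [update_of_ne hij.symm])) _).trans
      (add_le_opA hi)

/-- A chain with last letter `a` can skip a letter `c` of weight `r`, at no loss, or leave it to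
another chain. -/
def Absorb (a c : α) (r : ℝ≥0) (G : (ι → α) → ℝ≥0∞) : Prop :=
  ∀ v i B, v i ≤ a → G (update v i a) ≤ B →
    (∀ j, j ≠ i → v j ≤ c → r + G (update (update v i a) j c) ≤ B) → r + G (update v i c) ≤ B

theorem Absorb.of_good (hF : Good F) (hac : a ≤ c) : Absorb a c 0 F := fun v i B _ h _ => by
  rw [ENNReal.coe_zero, zero_add]
  exact (hF.anti (update_le_update_iff.2 ⟨hac, fun _ _ => le_rfl⟩)).trans h

theorem Absorb.mono {r' : ℝ≥0} (h : Absorb a c r G) (hr : r' ≤ r) : Absorb a c r' G := by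
  intro v i B hi h1 h2
  -- The hypothesis is applied with the bound raised by the surplus weight `d`, which is cancelled
  -- at the end.
  obtain ⟨d, rfl⟩ := exists_add_of_le hr
  have := h v i (B + d) hi (h1.trans le_self_add) fun j hj hjc => by
    rw [ENNReal.coe_add, add_right_comm]
    exact add_le_add_left (h2 j hj hjc) _
  rw [ENNReal.coe_add, add_right_comm] at this
  exact (ENNReal.add_le_add_iff_right (by simp)).1 this

/-- A chain at `c` cannot take `b`, whereas a chain at `a` can. If `b` is left out, chain `i` takes
it instead, gaining `s`. If another chain `j` takes it, chains `i` and `j` exchange the letters `c`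
and `b`. -/
theorem Absorb.opA (hG : Good G) (h : Absorb b c r G) (hab : a ≤ b) (hbc : b < c) :
    Absorb a c (r + s) (opA b s G) := by
  intro v i B hi h1 h2
  have hd : ∀ w : ι → α, w i ≤ b → s + (G (update w i b)) ≤ ChainOp.opA b s G w :=
    fun w hw => add_le_opA hw
  have hi' : v i ≤ b := hi.trans hab
  have h1' : s + G (update v i b) ≤ B := by
    refine le_trans ?_ h1
    simpa using hd (update v i a) (by simpa using hab)
  have h2' : ∀ j, j ≠ i → v j ≤ c → r + s + (s + G (update (update v i b) j c)) ≤ B := by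
    intro j hj hjc
    refine le_trans ?_ (h2 j hj hjc)
    rw [ENNReal.coe_add]
    refine add_le_add_right ?_ _
    have := hd (update (update v i a) j c) (by rw [update_of_ne hj.symm]; simpa using hab)
    rwa [show update (update (update v i a) j c) i b = update (update v i b) j c by
      rw [update_comm hj, update_idem]] at this
  refine add_opA_le (by simp) ?_ ?_
  · have hs : (s : ℝ≥0∞) ≤ B := le_self_add.trans h1'
    have := h v i (B - s) hi' ((ENNReal.le_sub_iff_add_le_left (by simp) hs).2 h1')
      fun j hj hjc => (ENNReal.le_sub_iff_add_le_left (by simp) hs).2 (by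
        refine le_trans ?_ (h2' j hj hjc)
        rw [← add_assoc, add_comm (s : ℝ≥0∞) r, add_assoc, add_assoc]
        exact add_le_add_right (add_le_add_right le_add_self _) _)
    rw [ENNReal.coe_add, add_comm (r : ℝ≥0∞) s, add_assoc]
    exact (ENNReal.le_sub_iff_add_le_left (by simp) hs).1 this
  · intro j hj
    have hji : j ≠ i := by
      rintro rfl
      simp [hbc.not_ge] at hj
    rw [update_of_ne hji] at hj
    -- Symmetry of `G` performs the exchange: chain `i` now ends in `b` and chain `j` in `c`.
    rw [hG.swap hji.symm, ENNReal.coe_add]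
    exact h2' j hji (hj.trans hbc.le)

/-- A choice for `ac` fails for `ca` only when the same chain takes both letters; this is the case
that `Absorb` replaces by an admissible one. -/
theorem Absorb.opA_comm_le (h : Absorb a c t G) :
    ChainOp.opA a s (ChainOp.opA c t G) ≤ ChainOp.opA c t (ChainOp.opA a s G) := fun v => by
  refine opA_le.2 ⟨opA_mono (fun _ => le_opA) v, fun i hi => add_opA_le (by simp) ?_ ?_⟩
  · exact (add_le_opA hi).trans le_opA
  · intro j hj
    have key : ∀ j, j ≠ i → v j ≤ c → s + (t + G (update (update v i a) j c)) ≤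
        ChainOp.opA c t (ChainOp.opA a s G) v := fun j hij hj => by
      rw [add_left_comm, update_comm hij.symm]
      exact (add_le_add_right (add_le_opA (by rwa [update_of_ne hij.symm])) _).trans
        (add_le_opA hj)
    by_cases hij : j = i
    · subst hij
      rw [update_idem]
      have h0 : s + G (update v j a) ≤ ChainOp.opA c t (ChainOp.opA a s G) v :=
        (add_le_opA hi).trans le_opA
      have hs := le_self_add.trans h0
      refine (ENNReal.le_sub_iff_add_le_left (by simp) hs).1 (h v j _ hi
        ((ENNReal.le_sub_iff_add_le_left (by simp) hs).2 h0) fun k hk hkc =>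
          (ENNReal.le_sub_iff_add_le_left (by simp) hs).2 (key k hk hkc))
    · exact key j hij (by rwa [update_of_ne hij] at hj)

/-- The operator of a word, given as a list of letters with weights. -/
noncomputable def opL (L : List (α × ℝ≥0)) (F : (ι → α) → ℝ≥0∞) : (ι → α) → ℝ≥0∞ :=
  L.foldr (fun x => opA x.1 x.2) F

@[simp] theorem opL_nil : opL [] F = F := rfl

@[simp] theorem opL_cons (x : α × ℝ≥0) (L) : opL (x :: L) F = opA x.1 x.2 (opL L F) := rfl

theorem opL_append (L L' : List (α × ℝ≥0)) : opL (L ++ L') F = opL L (opL L' F) :=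
  List.foldr_append

theorem Good.opL (hF : Good F) (L : List (α × ℝ≥0)) : Good (opL L F) := by
  induction L with
  | nil => exact hF
  | cons x L ih => exact ih.opA _ _

/-- The total weight of a word. -/
def weight (L : List (α × ℝ≥0)) : ℝ≥0 := (L.map Prod.snd).sum

@[simp] theorem weight_nil : weight ([] : List (α × ℝ≥0)) = 0 := rfl

@[simp] theorem weight_cons (x : α × ℝ≥0) (L) : weight (x :: L) = x.2 + weight L := by
  simp [weight]

theorem weight_append (L L' : List (α × ℝ≥0)) : weight (L ++ L') = weight L + weight L' := by
  simp [weight]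

/-- Instead of a `c` of weight `weight L`, a chain at `a` can follow the sorted word `L`, whose
letters lie in `[a, c)`; letters already used by other chains are handled by exchanging tails. -/
theorem Absorb.of_sorted (hF : Good F) (L : List (α × ℝ≥0))
    (hL : L.Pairwise fun x y => x.1 ≤ y.1) (hc : ∀ x ∈ L, x.1 < c) (ha : ∀ x ∈ L, a ≤ x.1)
    (hac : a ≤ c) : Absorb a c (weight L) (ChainOp.opL L F) := by
  induction L generalizing a with
  | nil => exact Absorb.of_good hF hac
  | cons x L ih =>
    rw [List.pairwise_cons] at hL
    rw [weight_cons, add_comm]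
    exact (ih hL.2 (fun y hy => hc y (by simp [hy])) hL.1 (hc x (by simp)).le).opA
      (hF.opL L) (ha x (by simp)) (hc x (by simp))

/-- The case of a single letter `c` of the first Knuth relation: `c` moves left across the letters
of `x` one at a time, and `y` following it has enough weight to absorb it. -/
theorem opL_letter_comm (hF : Good F) (x y : List (α × ℝ≥0))
    (hxy : (x ++ y).Pairwise fun x y => x.1 ≤ y.1) (hc : ∀ p ∈ x ++ y, p.1 < c)
    (ht : t ≤ weight y) : opL x (opA c t (opL y F)) = opA c t (opL x (opL y F)) := by
  induction x with
  | nil => rfl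
  | cons p x ih =>
    rw [List.cons_append, List.pairwise_cons] at hxy
    have hp : p.1 < c := hc p (by simp)
    rw [opL_cons, opL_cons, ih hxy.2 fun q hq => hc q (by simp at hq ⊢; tauto)]
    refine le_antisymm (Absorb.opA_comm_le ?_) (ChainOp.opA_comm_le hp)
    rw [← opL_append]
    refine (Absorb.of_sorted hF _ hxy.2 (fun q hq => hc q (by simp at hq ⊢; tauto)) hxy.1
      hp.le).mono ?_
    rw [weight_append]
    exact ht.trans le_add_self

/-- The letter that straddles the cut is divided in two; `opA_add` keeps the operator unchanged. -/
theorem exists_split (y : List (α × ℝ≥0)) (p : ℝ≥0) (hp : p ≤ weight y) :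
    ∃ y₁ y₂ : List (α × ℝ≥0), weight y₁ = p ∧ weight y₁ + weight y₂ = weight y ∧
      (∀ x ∈ y₁ ++ y₂, ∃ x' ∈ y, x'.1 = x.1) ∧
      (y.Pairwise (fun x y => x.1 ≤ y.1) → (y₁ ++ y₂).Pairwise fun x y => x.1 ≤ y.1) ∧
      ∀ F : (ι → α) → ℝ≥0∞, Good F → opL (y₁ ++ y₂) F = opL y F := by
  induction y generalizing p with
  | nil => exact ⟨[], [], by simpa using hp.antisymm' bot_le, by simp, by simp, by simp, by simp⟩
  | cons q y ih =>
    rw [weight_cons] at hp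
    rcases le_total p q.2 with h | h
    · obtain ⟨d, hd⟩ := exists_add_of_le h
      refine ⟨[(q.1, p)], (q.1, d) :: y, by simp, by simp [hd, add_assoc], ?_, ?_, ?_⟩
      · intro x hx
        simp only [List.cons_append, List.nil_append, List.mem_cons] at hx
        rcases hx with rfl | rfl | hx
        · exact ⟨q, by simp, rfl⟩
        · exact ⟨q, by simp, rfl⟩
        · exact ⟨x, by simp [hx], rfl⟩
      · intro hy
        rw [List.pairwise_cons] at hy
        simp only [List.cons_append, List.nil_append, List.pairwise_cons, List.mem_cons]
        refine ⟨?_, hy⟩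
        rintro x (rfl | hx)
        · exact le_rfl
        · exact hy.1 x hx
      · intro F hF
        simp [hd, opA_add (hF.opL y)]
    · obtain ⟨d, hd⟩ := exists_add_of_le h
      rw [hd] at hp
      obtain ⟨y₁, y₂, h1, h2, h3, h4, h5⟩ := ih d (le_of_add_le_add_left hp)
      refine ⟨q :: y₁, y₂, by simp [h1, hd], by simp [← h2, add_assoc], ?_, ?_, ?_⟩
      · intro x hx
        rw [List.cons_append, List.mem_cons] at hx
        rcases hx with rfl | hx
        · exact ⟨x, by simp, rfl⟩
        · obtain ⟨x', hx', e⟩ := h3 x hx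
          exact ⟨x', by simp [hx'], e⟩
      · intro hy
        rw [List.pairwise_cons] at hy
        rw [List.cons_append, List.pairwise_cons]
        refine ⟨fun x hx => ?_, h4 hy.2⟩
        obtain ⟨x', hx', e⟩ := h3 x hx
        exact e ▸ hy.1 x' hx'
      · intro F hF
        simp [h5 F hF]

/-- The first timed Knuth relation holds for the operators. -/
theorem opL_comm (hF : Good F) (x y z : List (α × ℝ≥0))
    (hxy : (x ++ y).Pairwise fun x y => x.1 ≤ y.1) (hz : z.Pairwise fun x y => x.1 ≤ y.1)
    (hlt : ∀ p ∈ x ++ y, ∀ q ∈ z, p.1 < q.1) (hw : weight z ≤ weight y) :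
    opL x (opL z (opL y F)) = opL z (opL x (opL y F)) := by
  induction z generalizing x y F with
  | nil => rfl
  | cons c z ih =>
    rw [List.pairwise_cons] at hz
    rw [weight_cons] at hw
    -- The part `y₁` has the weight of the first letter `c` of `z` and serves to absorb it; `y₂`
    -- remains for the rest of `z`.
    obtain ⟨y₁, y₂, h1, h2, h3, h4, h5⟩ := exists_split (ι := ι) y c.2 (le_self_add.trans hw)
    have hx := List.pairwise_append.1 hxy
    have hxy' : (x ++ y₁ ++ y₂).Pairwise fun x y => x.1 ≤ y.1 := by
      rw [List.append_assoc]
      refine List.pairwise_append.2 ⟨hx.1, h4 hx.2.1, fun p hp q hq => ?_⟩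
      obtain ⟨q', hq', e⟩ := h3 q hq
      exact e ▸ hx.2.2 p hp q' hq'
    have hlt' : ∀ p ∈ x ++ y₁ ++ y₂, ∀ q ∈ c :: z, p.1 < q.1 := by
      intro p hp q hq
      rw [List.append_assoc, List.mem_append] at hp
      rcases hp with hp | hp
      · exact hlt p (by simp [hp]) q hq
      · obtain ⟨p', hp', e⟩ := h3 p hp
        exact e ▸ hlt p' (by simp [hp']) q hq
    have hw2 : weight z ≤ weight y₂ := by
      rw [← h2, h1] at hw
      exact le_of_add_le_add_left hw
    rw [← h5 F hF, opL_append, opL_cons, opL_cons]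
    have hxy2 : (y₁ ++ y₂).Pairwise fun x y => x.1 ≤ y.1 := h4 hx.2.1
    -- With `z` now the rest, the words run `x c z y₁ y₂`, `x c y₁ z y₂`, `c x y₁ z y₂`, `c z x y₁
    -- y₂`.
    rw [← ih hF y₁ y₂ hxy2 hz.2 (fun p hp q hq => hlt' p (by
        simp at hp ⊢; tauto) q (by simp [hq])) hw2,
      opL_letter_comm ((hF.opL _).opL _) x y₁ (List.pairwise_append.1 hxy').1
        (fun p hp => hlt' p (by simp at hp ⊢; tauto) c (by simp)) h1.ge,
      ← opL_append x y₁, ih hF (x ++ y₁) y₂ hxy' hz.2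
        (fun p hp q hq => hlt' p hp q (by simp [hq])) hw2, opL_append]

/-! ### Duality under reversal of the word and of the alphabet. -/

/-- The pairing of functions of the initial and of the final state. -/
noncomputable def pair (F : (ι → α) → ℝ≥0∞) (H : (ι → αᵒᵈ) → ℝ≥0∞) : ℝ≥0∞ :=
  ⨆ v : ι → α, (F v + H (toDual ∘ v))

theorem le_pair (F : (ι → α) → ℝ≥0∞) (H : (ι → αᵒᵈ) → ℝ≥0∞) (v : ι → α) :
    F v + H (toDual ∘ v) ≤ pair F H := le_iSup (fun v : ι → α => F v + H (toDual ∘ v)) v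

/-- The reversed word over the dual alphabet. -/
def dualList (L : List (α × ℝ≥0)) : List (αᵒᵈ × ℝ≥0) :=
  (L.map fun x => (toDual x.1, x.2)).reverse

/-- A letter may be credited to the future, evaluated by `F`, or to the past, evaluated by `H`. To
pass from one to the other, the intermediate state is moved across the letter, and antitonicity
compares the remaining values. -/
theorem pair_opA {H : (ι → αᵒᵈ) → ℝ≥0∞} (hF : Good F) (hH : Good H) (a : α) (s : ℝ≥0) :
    pair (opA a s F) H = pair F (opA (toDual a) s H) := by
  have hup : ∀ (v : ι → α) i, update (toDual ∘ v) i (toDual a) = toDual ∘ update v i a :=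
    fun v i => (comp_update _ _ _ _).symm
  refine le_antisymm (iSup_le fun v => ?_) (iSup_le fun v => ?_)
  · rw [add_comm]
    -- An infinite value is treated apart because `add_opA_le` needs a finite summand.
    by_cases hv : H (toDual ∘ v) = ∞
    · refine le_trans ?_ (le_pair _ _ v)
      rw [top_le_iff.1 (hv.ge.trans (le_opA (a := toDual a) (s := s)))]
      simp
    refine add_opA_le hv ?_ fun i hi => ?_
    · refine le_trans ?_ (le_pair _ _ v)
      rw [add_comm]
      exact add_le_add_right le_opA _
    · refine le_trans ?_ (le_pair _ _ (update v i a))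
      rw [add_comm, add_right_comm, add_comm]
      refine add_le_add_right ?_ _
      refine le_trans ?_ (add_le_opA (i := i) (by simp))
      rw [hup, update_idem, ← hup]
      exact add_le_add_right (hH.anti (update_le_iff.2 ⟨hi, fun _ _ => le_rfl⟩)) _
  · by_cases hv : F v = ∞
    · refine le_trans ?_ (le_pair _ _ v)
      rw [top_le_iff.1 (hv.ge.trans (le_opA (a := a) (s := s)))]
      simp
    refine add_opA_le hv ?_ fun i hi => ?_
    · exact le_trans (add_le_add_left le_opA _) (le_pair _ _ v)
    · refine le_trans ?_ (le_pair _ _ (update v i a))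
      rw [← add_assoc, hup]
      refine add_le_add_left ?_ _
      rw [add_comm]
      refine le_trans ?_ (add_le_opA (i := i) (by simp))
      rw [update_idem]
      exact add_le_add_right (hF.anti (update_le_iff.2 ⟨hi, fun _ _ => le_rfl⟩)) _

theorem pair_opL {H : (ι → αᵒᵈ) → ℝ≥0∞} (hF : Good F) (hH : Good H) (L : List (α × ℝ≥0)) :
    pair (opL L F) H = pair F (opL (dualList L) H) := by
  induction L generalizing H with
  | nil => rfl
  | cons x L ih =>
    have : dualList (x :: L) = dualList L ++ [(toDual x.1, x.2)] := by simp [dualList]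
    rw [opL_cons, pair_opA (hF.opL L) hH, ih (hH.opA _ _), this, opL_append]
    rfl

/-- The second timed Knuth relation holds for the operators, in the dual form. -/
theorem pair_opL_comm {H : (ι → αᵒᵈ) → ℝ≥0∞} (hF : Good F) (hH : Good H) (x y z : List (α × ℝ≥0))
    (hyz : (y ++ z).Pairwise fun x y => x.1 ≤ y.1) (hx : x.Pairwise fun x y => x.1 ≤ y.1)
    (hlt : ∀ p ∈ x, ∀ q ∈ y ++ z, p.1 < q.1) (hw : weight x ≤ weight y) :
    pair (opL y (opL x (opL z F))) H = pair (opL y (opL z (opL x F))) H := by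
  have hrev : ∀ L : List (α × ℝ≥0), L.Pairwise (fun x y => x.1 ≤ y.1) →
      List.Pairwise (fun x y : αᵒᵈ × ℝ≥0 => x.1 ≤ y.1) (dualList L) :=
    fun L hL => List.pairwise_reverse.2 (List.pairwise_map.2 hL)
  have hwt : ∀ L : List (α × ℝ≥0), weight (dualList L) = weight L := fun L => by
    unfold weight dualList
    rw [List.map_reverse, List.sum_reverse, List.map_map]
    rfl
  have hmem : ∀ (L : List (α × ℝ≥0)) (p : αᵒᵈ × ℝ≥0), p ∈ dualList L →
      (ofDual p.1, p.2) ∈ L := by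
    intro L p hp
    obtain ⟨q, hq, rfl⟩ := List.mem_map.1 (List.mem_reverse.1 hp)
    exact hq
  have happ : ∀ L L' : List (α × ℝ≥0), dualList L ++ dualList L' = dualList (L' ++ L) :=
    fun L L' => by simp [dualList]
  rw [pair_opL ((hF.opL _).opL _) hH, pair_opL (hF.opL _) (hH.opL _),
    pair_opL hF ((hH.opL _).opL _), pair_opL ((hF.opL _).opL _) hH,
    pair_opL (hF.opL _) (hH.opL _), pair_opL hF ((hH.opL _).opL _)]
  -- In the dual alphabet the reversed words `z y` are sorted and lie below `x`, so this is the
  -- first relation.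
  rw [opL_comm hH (dualList z) (dualList y) (dualList x)]
  · rw [happ]
    exact hrev _ hyz
  · exact hrev _ hx
  · intro p hp q hq
    rw [happ] at hp
    exact hlt _ (hmem _ _ hq) _ (hmem _ _ hp)
  · rw [hwt, hwt]
    exact hw

end ChainOp

/-! ### Knuth invariance of the chain maxima. -/

namespace TimedWord

open ChainOp

variable {n : ℕ}

/-- Functions of the state of `k` chains in the alphabet `ℕ` which are antitone and symmetric. -/
abbrev ChainFun (k : ℕ) : Type := {F : (Fin k → ℕ) → ℝ≥0∞ // Good F}

/-- The operator of a letter, or the identity if the letter is at least `m`. -/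
noncomputable def letterOp (k m : ℕ) (a : Fin n) (s : ℝ≥0) : Function.End (ChainFun k) :=
  fun F => if (a : ℕ) < m then ⟨opA (a : ℕ) s F.1, F.2.opA _ _⟩ else F

theorem letterOp_of_lt {k m : ℕ} {a : Fin n} (h : (a : ℕ) < m) (s : ℝ≥0) (F : ChainFun k) :
    letterOp k m a s F = ⟨opA (a : ℕ) s F.1, F.2.opA _ _⟩ := if_pos h

theorem letterOp_of_not_lt {k m : ℕ} {a : Fin n} (h : ¬ (a : ℕ) < m) (s : ℝ≥0) (F : ChainFun k) :
    letterOp k m a s F = F := if_neg h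

theorem letterOp_zero (k m : ℕ) (a : Fin n) : letterOp k m a 0 = 1 := by
  funext F
  by_cases h : (a : ℕ) < m
  · rw [letterOp_of_lt h]
    exact Subtype.ext (opA_zero F.2 _)
  · exact letterOp_of_not_lt h _ _

theorem letterOp_add (k m : ℕ) (a : Fin n) (s t : ℝ≥0) :
    letterOp k m a (s + t) = letterOp k m a s * letterOp k m a t := by
  funext F
  change _ = letterOp k m a s (letterOp k m a t F)
  by_cases h : (a : ℕ) < m
  · rw [letterOp_of_lt h, letterOp_of_lt h, letterOp_of_lt h]
    exact Subtype.ext (opA_add F.2 _ _ _)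
  · rw [letterOp_of_not_lt h, letterOp_of_not_lt h, letterOp_of_not_lt h]

/-- The action of timed words on functions of the state of `k` chains, in which all letters
that are at least `m` are ignored. -/
noncomputable def chainHom (k m : ℕ) : TimedWord n →* Function.End (ChainFun k) :=
  lift (letterOp k m) (letterOp_zero k m) (letterOp_add k m)

/-- The letters less than `m` of a list, as natural numbers. -/
def trunc (m : ℕ) (L : List (Fin n × ℝ≥0)) : List (ℕ × ℝ≥0) :=
  (L.map fun x => ((x.1 : ℕ), x.2)).filter fun x => x.1 < m

theorem chainHom_seg (k m : ℕ) (a : Fin n) (s : ℝ≥0) :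
    chainHom k m (seg a s) = letterOp k m a s := by
  have := lift_spell (letterOp (n := n) k m) (letterOp_zero k m) (letterOp_add k m) [(a, s)]
  rw [spell_cons, spell_nil, mul_one] at this
  rw [chainHom, this]
  simp

theorem chainHom_spell (k m : ℕ) (L : List (Fin n × ℝ≥0)) (F : ChainFun k) :
    (chainHom k m (spell L) F).1 = opL (trunc m L) F.1 := by
  induction L with
  | nil =>
    rw [spell_nil, map_one]
    rfl
  | cons x L ih =>
    rw [spell_cons, map_mul, chainHom_seg]
    change (letterOp k m x.1 x.2 (chainHom k m (spell L) F)).1 = _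
    by_cases h : (x.1 : ℕ) < m
    · rw [letterOp_of_lt h]
      simp only [trunc, List.map_cons] at ih ⊢
      rw [List.filter_cons_of_pos (by simpa using h), opL_cons, ih]
    · rw [letterOp_of_not_lt h]
      simp only [trunc, List.map_cons] at ih ⊢
      rw [List.filter_cons_of_neg (by simpa using h), ← ih]

/-- Timed words are related if their actions on chains cannot be distinguished. -/
noncomputable def chainCon (n : ℕ) : Con (TimedWord n) where
  r w w' := ∀ (k m : ℕ) (F : ChainFun k) (H : (Fin k → ℕᵒᵈ) → ℝ≥0∞), Good H →
    pair (chainHom k m w F).1 H = pair (chainHom k m w' F).1 H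
  iseqv := ⟨fun _ _ _ _ _ _ => rfl, fun h k m F H hH => (h k m F H hH).symm,
    fun h h' k m F H hH => (h k m F H hH).trans (h' k m F H hH)⟩
  mul' := by
    intro w w' u u' hw hu k m F H hH
    obtain ⟨L, rfl⟩ := exists_spell w'
    rw [map_mul, map_mul]
    refine (hw k m (chainHom k m u F) H hH).trans ?_
    change pair (chainHom k m (spell L) (chainHom k m u F)).1 H =
      pair (chainHom k m (spell L) (chainHom k m u' F)).1 H
    -- The common left factor is moved into `H`, so that the relation between the right factors
    -- applies.
    rw [chainHom_spell, chainHom_spell, pair_opL (chainHom k m u F).2 hH,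
      pair_opL (chainHom k m u' F).2 hH]
    exact hu k m F _ (hH.opL _)

/-- Since the alphabet is discrete, the limit letter is attained arbitrarily close to the end, and a
row is increasing. -/
theorem val_le_of_hasEndLimit {w : TimedWord n} (hw : w.IsRow) {a : Fin n} (h : w.HasEndLimit a)
    {t : ℝ} (h0 : 0 ≤ t) (h1 : t < w.length) : w.val t ≤ a := by
  have h2 : ∀ᶠ s in comap Subtype.val (𝓝[<] w.length), w.toFun s = a := by
    have := h.eventually (show ∀ᶠ b in 𝓝 a, b = a by simp)
    exact this
  rw [eventually_comap] at h2
  have h3 : ∀ᶠ s in 𝓝[<] w.length, s ∈ Set.Ioo t w.length := Ioo_mem_nhdsLT h1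
  obtain ⟨s, hs, hs'⟩ := (h2.and h3).exists
  have hs0 : s ∈ Set.Ico (0 : ℝ) w.length := ⟨h0.trans hs'.1.le, hs'.2⟩
  have := hs ⟨s, hs0⟩ rfl
  rw [← this, ← val_eq hs0]
  exact isRow_iff.1 hw t s h0 hs'.1.le hs'.2

theorem trunc_append (m : ℕ) (L L' : List (Fin n × ℝ≥0)) :
    trunc m (L ++ L') = trunc m L ++ trunc m L' := by simp [trunc]

theorem mem_trunc {m : ℕ} {L : List (Fin n × ℝ≥0)} {p : ℕ × ℝ≥0} (hp : p ∈ trunc m L) :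
    p.1 < m ∧ ∃ q ∈ L, (q.1 : ℕ) = p.1 := by
  obtain ⟨h1, h2⟩ := List.mem_filter.1 hp
  obtain ⟨q, hq, rfl⟩ := List.mem_map.1 h1
  exact ⟨by simpa using h2, q, hq, rfl⟩

theorem pairwise_trunc (m : ℕ) {L : List (Fin n × ℝ≥0)} (h : L.Pairwise fun x y => x.1 ≤ y.1) :
    (trunc m L).Pairwise fun x y => x.1 ≤ y.1 :=
  List.Pairwise.filter _ (List.pairwise_map.2 h)

theorem weight_trunc_le (m : ℕ) (L : List (Fin n × ℝ≥0)) :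
    weight (trunc m L) ≤ (L.map Prod.snd).sum := by
  induction L with
  | nil => simp [trunc]
  | cons x L ih =>
    simp only [trunc, List.map_cons, List.sum_cons] at ih ⊢
    by_cases h : (x.1 : ℕ) < m
    · rw [List.filter_cons_of_pos (by simpa using h), weight_cons]
      exact add_le_add_right ih _
    · rw [List.filter_cons_of_neg (by simpa using h)]
      exact ih.trans le_add_self

theorem weight_trunc_eq {m : ℕ} {L : List (Fin n × ℝ≥0)} (h : ∀ x ∈ L, (x.1 : ℕ) < m) :
    weight (trunc m L) = (L.map Prod.snd).sum := by
  induction L with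
  | nil => simp [trunc]
  | cons x L ih =>
    have ih := ih fun y hy => h y (by simp [hy])
    simp only [trunc, List.map_cons, List.sum_cons] at ih ⊢
    rw [List.filter_cons_of_pos (by simpa using h x (by simp)), weight_cons, ih]

/-- Either truncation empties `x`, or some letter of `x` is below `m` and then `y` survives
completely. -/
theorem weight_trunc_le_of_lt {m : ℕ} {x y : List (Fin n × ℝ≥0)}
    (hl : (spell x).length = (spell y).length) (hlt : ∀ p ∈ y, ∀ q ∈ x, p.1 < q.1) :
    weight (trunc m x) ≤ weight (trunc m y) := by
  rcases hx : trunc m x with _ | ⟨p, l⟩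
  · simp
  · obtain ⟨h1, q, hq, hq'⟩ := mem_trunc (hx ▸ List.mem_cons_self : p ∈ trunc m x)
    rw [← hx, weight_trunc_eq (L := y) fun r hr => (hq' ▸ hlt r hr q hq : (r.1 : ℕ) < p.1).trans h1]
    rw [length_spell, length_spell] at hl
    rw [← NNReal.eq hl]
    exact weight_trunc_le m x

theorem exists_mem_of_pos {L : List (Fin n × ℝ≥0)} (h : 0 < (spell L).length) : ∃ x, x ∈ L := by
  obtain ⟨x, hx, -⟩ := exists_mem_of_val le_rfl h
  exact ⟨x, hx⟩

/-- The letters of a row that ends below the first letter of another row are less than those of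
the latter. -/
theorem lt_of_hasEndLimit {y z : List (Fin n × ℝ≥0)} (hy : (spell y).IsRow) (hz : (spell z).IsRow)
    (hy0 : ∀ x ∈ y, 0 < x.2) (hz0 : ∀ x ∈ z, 0 < x.2) (hpos : 0 < (spell z).length)
    {a : Fin n} (ha : (spell y).HasEndLimit a) (hlt : a < (spell z).toFun ⟨0, le_rfl, hpos⟩) :
    ∀ p ∈ y, ∀ q ∈ z, p.1 < q.1 := by
  intro p hp q hq
  obtain ⟨s, hs0, hs1, hs⟩ := exists_val_eq hp (hy0 p hp)
  obtain ⟨t, ht0, ht1, ht⟩ := exists_val_eq hq (hz0 q hq)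
  have h1 := val_le_of_hasEndLimit hy ha hs0 hs1
  have h2 := isRow_iff.1 hz 0 t le_rfl ht0 ht1
  rw [val_eq ⟨le_rfl, hpos⟩, ht] at h2
  rw [hs] at h1
  exact (Fin.lt_def.2 (h1.trans_lt (Fin.lt_def.1 hlt))).trans_le (Fin.le_def.2 h2)

/-- Truncation can destroy the equality of lengths, but the operator relations need only an
inequality of weights, and this survives. -/
theorem knuthCon_le_chainCon : knuthCon n ≤ chainCon n := by
  refine Con.conGen_le.2 fun u v huv => ?_
  induction huv with
  | kappa₁ x y z hx hy hz hxyz hl hpos a ha hlt =>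
    obtain ⟨x, rfl, hx0⟩ := exists_spell_pos x
    obtain ⟨y, rfl, hy0⟩ := exists_spell_pos y
    obtain ⟨z, rfl, hz0⟩ := exists_spell_pos z
    intro k m F H hH
    have hyz := lt_of_hasEndLimit hy hz hy0 hz0 hpos ha hlt
    have hsort : (x ++ y ++ z).Pairwise fun x y => x.1 ≤ y.1 :=
      pairwise_of_isRow (by
        simp only [List.mem_append]
        rintro p ((h | h) | h)
        exacts [hx0 p h, hy0 p h, hz0 p h])
        (by rwa [spell_append, spell_append])
    obtain ⟨hxy, hzs, hle⟩ := List.pairwise_append.1 hsort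
    obtain ⟨r, hr⟩ := exists_mem_of_pos (hl ▸ hpos)
    rw [← spell_append, ← spell_append, ← spell_append, ← spell_append, chainHom_spell,
      chainHom_spell]
    simp only [trunc_append, opL_append]
    rw [opL_comm F.2]
    · rw [← trunc_append]
      exact pairwise_trunc m hxy
    · exact pairwise_trunc m hzs
    · intro p hp q hq
      rw [← trunc_append] at hp
      obtain ⟨-, p', hp', ep⟩ := mem_trunc hp
      obtain ⟨-, q', hq', eq⟩ := mem_trunc hq
      rw [← ep, ← eq]
      rcases List.mem_append.1 hp' with h | h
      · exact lt_of_le_of_lt ((List.pairwise_append.1 hxy).2.2 p' h r hr) (hyz r hr q' hq')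
      · exact hyz p' h q' hq'
    · exact weight_trunc_le_of_lt hl hyz
  | kappa₂ x y z hx hy hz hxyz hl hpos a ha hlt =>
    obtain ⟨x, rfl, hx0⟩ := exists_spell_pos x
    obtain ⟨y, rfl, hy0⟩ := exists_spell_pos y
    obtain ⟨z, rfl, hz0⟩ := exists_spell_pos z
    intro k m F H hH
    have hxy := lt_of_hasEndLimit hx hy hx0 hy0 hpos ha hlt
    have hsort : (x ++ (y ++ z)).Pairwise fun x y => x.1 ≤ y.1 :=
      pairwise_of_isRow (by
        simp only [List.mem_append]
        rintro p (h | h | h)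
        exacts [hx0 p h, hy0 p h, hz0 p h])
        (by rwa [spell_append, spell_append, ← mul_assoc])
    obtain ⟨hxs, hyz, hle⟩ := List.pairwise_append.1 hsort
    obtain ⟨r, hr⟩ := exists_mem_of_pos hpos
    rw [← spell_append, ← spell_append, ← spell_append, ← spell_append, chainHom_spell,
      chainHom_spell]
    simp only [trunc_append, opL_append]
    -- If `z` disappears, both sides are equal. Otherwise a letter of `z` is below `m`, hence so are
    -- all letters of `y`, and `y` keeps its full weight.
    by_cases hz1 : trunc m z = []
    · rw [hz1]
      rfl
    obtain ⟨p, hp⟩ := List.exists_mem_of_ne_nil _ hz1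
    obtain ⟨hpm, p', hp', ep⟩ := mem_trunc hp
    rw [pair_opL_comm F.2 hH]
    · rw [← trunc_append]
      exact pairwise_trunc m hyz
    · exact pairwise_trunc m hxs
    · intro p hp q hq
      rw [← trunc_append] at hq
      obtain ⟨-, p', hp', ep⟩ := mem_trunc hp
      obtain ⟨-, q', hq', eq⟩ := mem_trunc hq
      rw [← ep, ← eq]
      rcases List.mem_append.1 hq' with h | h
      · exact hxy p' hp' q' h
      · exact lt_of_lt_of_le (hxy p' hp' r hr) ((List.pairwise_append.1 hyz).2.2 r hr q' h)
    · rw [weight_trunc_eq (L := y) fun q hq => ?_]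
      · rw [length_spell, length_spell] at hl
        rw [← NNReal.eq hl]
        exact weight_trunc_le m x
      · have := (List.pairwise_append.1 hyz).2.2 q hq p' hp'
        exact lt_of_le_of_lt (Fin.le_def.1 this) (ep ▸ hpm)

/-- The greatest total length of a family of `k` disjoint weakly increasing subwords of `w` with
letters less than `m`. -/
noncomputable def chainMax (k m : ℕ) (w : TimedWord n) : ℝ≥0∞ :=
  (chainHom k m w ⟨0, Good.zero⟩).1 0

theorem chainMax_eq_of_knuthCon {w w' : TimedWord n} (h : knuthCon n w w') (k m : ℕ) :
    chainMax k m w = chainMax k m w' := by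
  have key : ∀ w : TimedWord n, pair (chainHom k m w ⟨0, Good.zero⟩).1 (fun _ => 0) =
      chainMax k m w := by
    intro w
    -- Against the zero function the supremum is attained at the lowest state, by antitonicity.
    refine le_antisymm (iSup_le fun v => ?_) ?_
    · rw [add_zero]
      exact (chainHom k m w ⟨0, Good.zero⟩).2.anti (zero_le)
    · have := le_pair (chainHom k m w ⟨0, Good.zero⟩).1 (fun _ => 0) 0
      rwa [add_zero] at this
  rw [← key, ← key]
  exact knuthCon_le_chainCon h k m _ _ Good.zero

end TimedWord

/-! ### Rows and tableaux in terms of cumulative lengths. -/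

namespace TimedWord

open ChainOp MeasureTheory

variable {n : ℕ}

/-- The constant word with letter `a` and length `s`, or the empty word if `a` is not a letter
or `s` is negative. -/
noncomputable def segN (n a : ℕ) (s : ℝ) : TimedWord n :=
  if h : a < n then seg ⟨a, h⟩ s.toNNReal else 1

theorem segN_of_lt {a : ℕ} (h : a < n) (s : ℝ) : segN n a s = seg ⟨a, h⟩ s.toNNReal := dif_pos h

@[simp] theorem segN_zero (a : ℕ) : segN n a 0 = 1 := by
  unfold segN
  split_ifs <;> simp

theorem segN_of_not_lt {a : ℕ} (h : ¬ a < n) (s : ℝ) : segN n a s = 1 := dif_neg h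

theorem segN_add (a : ℕ) {s t : ℝ} (hs : 0 ≤ s) (ht : 0 ≤ t) :
    segN n a (s + t) = segN n a s * segN n a t := by
  by_cases h : a < n
  · rw [segN_of_lt h, segN_of_lt h, segN_of_lt h, Real.toNNReal_add hs ht, seg_add]
  · simp [segN_of_not_lt h]

theorem length_segN {a : ℕ} (h : a < n) {s : ℝ} (hs : 0 ≤ s) : (segN n a s).length = s := by
  rw [segN_of_lt h, length_seg, Real.coe_toNNReal _ hs]

/-- A row is described by the function `P` for which `P c` is the total length of its letters
less than `c`. -/
structure IsCum (P : ℕ → ℝ) : Prop where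
  zero : P 0 = 0
  mono : Monotone P

theorem IsCum.nonneg {P : ℕ → ℝ} (h : IsCum P) (c : ℕ) : 0 ≤ P c := h.zero ▸ h.mono c.zero_le

theorem IsCum.sub_nonneg {P : ℕ → ℝ} (h : IsCum P) (c : ℕ) : 0 ≤ P (c + 1) - P c :=
  _root_.sub_nonneg.2 (h.mono c.le_succ)

/-- The part with letters in `[i, i + d)` of the row described by `P`. -/
noncomputable def rowPart (n : ℕ) (P : ℕ → ℝ) (i : ℕ) : ℕ → TimedWord n
  | 0 => 1
  | d + 1 => rowPart n P i d * segN n (i + d) (P (i + d + 1) - P (i + d))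

/-- The row described by `P`. -/
noncomputable def row (n : ℕ) (P : ℕ → ℝ) : TimedWord n := rowPart n P 0 n

theorem rowPart_succ (P : ℕ → ℝ) (i d : ℕ) : rowPart n P i (d + 1) =
    rowPart n P i d * segN n (i + d) (P (i + d + 1) - P (i + d)) := rfl

theorem rowPart_add (P : ℕ → ℝ) (i d e : ℕ) :
    rowPart n P i (d + e) = rowPart n P i d * rowPart n P (i + d) e := by
  induction e with
  | zero => simp [rowPart]
  | succ e ih => rw [← add_assoc, rowPart_succ, ih, rowPart_succ, mul_assoc, add_assoc i d e]

theorem rowPart_congr {P Q : ℕ → ℝ} {i d : ℕ} (h : ∀ c, i ≤ c → c ≤ i + d → P c = Q c) :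
    rowPart n P i d = rowPart n Q i d := by
  induction d with
  | zero => rfl
  | succ d ih =>
    rw [rowPart_succ, rowPart_succ, ih fun c h1 h2 => h c h1 (by omega), h _ (by omega) (by omega),
      h _ (by omega) (by omega)]

theorem length_rowPart {P : ℕ → ℝ} (hP : Monotone P) {i d : ℕ} (hd : i + d ≤ n) :
    (rowPart n P i d).length = P (i + d) - P i := by
  induction d with
  | zero => simp [rowPart]
  | succ d ih =>
    rw [rowPart_succ, length_mul, ih (by omega),
      length_segN (by omega) (sub_nonneg.2 (hP (by omega)))]
    ring_nf

theorem length_row {P : ℕ → ℝ} (hP : IsCum P) : (row n P).length = P n := by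
  rw [row, length_rowPart hP.mono (by omega), hP.zero, zero_add, sub_zero]

theorem val_rowPart_lt_iff {P : ℕ → ℝ} (hP : IsCum P) {d : ℕ} (hd : d ≤ n) {t : ℝ} (h0 : 0 ≤ t)
    (h1 : t < P d) {c : ℕ} (hc : c ≤ d) : (rowPart n P 0 d).val t < c ↔ t < P c := by
  induction d generalizing c with
  | zero => rw [hP.zero] at h1; linarith
  | succ d ih =>
    have hl : (rowPart n P 0 d).length = P d := by
      rw [length_rowPart hP.mono (by omega), hP.zero, zero_add, sub_zero]
    rw [rowPart_succ, val_mul, hl]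
    split_ifs with h
    · rcases Nat.lt_or_ge c (d + 1) with h' | h'
      · exact ih (by omega) h (by omega)
      · obtain rfl : c = d + 1 := by omega
        exact iff_of_true (((ih (by omega) h le_rfl).2 h).trans (Nat.lt_succ_self d)) h1
    · rw [zero_add, segN_of_lt (show d < n by omega), val_seg (by linarith)
        (by rw [Real.coe_toNNReal _ (hP.sub_nonneg d)]; linarith)]
      rcases Nat.lt_or_ge c (d + 1) with h' | h'
      · have := hP.mono (show c ≤ d by omega)
        exact iff_of_false (by simp; omega) (by linarith)
      · obtain rfl : c = d + 1 := by omega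
        exact iff_of_true (by simp) h1

theorem val_row_lt_iff {P : ℕ → ℝ} (hP : IsCum P) {t : ℝ} (h0 : 0 ≤ t) (h1 : t < P n) {c : ℕ}
    (hc : c ≤ n) : (row n P).val t < c ↔ t < P c := val_rowPart_lt_iff hP le_rfl h0 h1 hc

theorem isRow_row {P : ℕ → ℝ} (hP : IsCum P) : (row n P).IsRow := by
  refine isRow_iff.2 fun s t hs hst ht => ?_
  rw [length_row hP] at ht
  have hn := (val_row_lt_iff hP (hs.trans hst) ht le_rfl).2 ht
  have h1 := (val_row_lt_iff hP (hs.trans hst) ht hn).1 (Nat.lt_succ_self _)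
  exact Nat.lt_succ_iff.1 ((val_row_lt_iff hP hs (hst.trans_lt ht) hn).2 (hst.trans_lt h1))

theorem dominatedBy_iff {u v : TimedWord n} : u.DominatedBy v ↔ v.length ≤ u.length ∧
    ∀ t, 0 ≤ t → t < v.length → u.val t < v.val t := by
  refine and_congr_right fun hl => ⟨fun h t h0 h1 => ?_, fun h t hu hv => ?_⟩
  · rw [val_eq ⟨h0, h1⟩, val_eq ⟨h0, h1.trans_le hl⟩]
    exact h t _ _
  · have := h t hv.1 hv.2
    rwa [val_eq hu, val_eq hv] at this

/-- The upper row has a letter at most `c` exactly at times `t < Q (c + 1)`, and there the lower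
letter must be below `c`, that is, `t < P c`. -/
theorem dominatedBy_row_iff {P Q : ℕ → ℝ} (hP : IsCum P) (hQ : IsCum Q) :
    (row n P).DominatedBy (row n Q) ↔ ∀ c < n, Q (c + 1) ≤ P c := by
  rw [dominatedBy_iff, length_row hP, length_row hQ]
  constructor
  · rintro ⟨hl, h⟩ c hc
    by_contra! hlt
    have h1 : P c < Q n := hlt.trans_le (hQ.mono hc)
    have h2 := h _ (hP.nonneg c) h1
    have h3 := (val_row_lt_iff hQ (hP.nonneg c) h1 hc).2 hlt
    have h4 := (val_row_lt_iff hP (hP.nonneg c) (h1.trans_le hl) hc.le).1 (by omega)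
    exact lt_irrefl _ h4
  · intro h
    have hl : Q n ≤ P n := by
      rcases Nat.eq_zero_or_pos n with rfl | hn
      · rw [hP.zero, hQ.zero]
      · obtain ⟨m, rfl⟩ := Nat.exists_eq_succ_of_ne_zero hn.ne'
        exact (h m (by omega)).trans (hP.mono (by omega))
    refine ⟨hl, fun t h0 h1 => ?_⟩
    have hn := (val_row_lt_iff hQ h0 h1 le_rfl).2 h1
    have h2 := (val_row_lt_iff hQ h0 h1 hn).1 (Nat.lt_succ_self _)
    exact (val_row_lt_iff hP h0 (h1.trans_le hl) hn.le).2 (h2.trans_le (h _ hn))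

/-- The total length of the letters less than `c` in a list. -/
noncomputable def cumList (L : List (Fin n × ℝ≥0)) (c : ℕ) : ℝ :=
  (L.map fun x => if (x.1 : ℕ) < c then (x.2 : ℝ) else 0).sum

@[simp] theorem cumList_cons (x : Fin n × ℝ≥0) (L) (c : ℕ) :
    cumList (x :: L) c = (if (x.1 : ℕ) < c then (x.2 : ℝ) else 0) + cumList L c := by
  simp [cumList]

theorem isCum_cumList (L : List (Fin n × ℝ≥0)) : IsCum (cumList L) := by
  refine ⟨by simp [cumList], fun c d hcd => ?_⟩
  refine List.sum_le_sum fun x _ => ?_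
  have := x.2.2
  split_ifs <;> first | omega | simp

theorem cumList_eq_length (L : List (Fin n × ℝ≥0)) : cumList L n = (spell L).length := by
  induction L with
  | nil => simp [cumList]
  | cons x L ih => simp [ih]

theorem cumList_eq_zero {L : List (Fin n × ℝ≥0)} {c : ℕ} (h : ∀ x ∈ L, c ≤ (x.1 : ℕ)) :
    cumList L c = 0 := by
  induction L with
  | nil => simp [cumList]
  | cons x L ih =>
    have h1 := h x (by simp)
    rw [cumList_cons, ih fun y hy => h y (by simp [hy]), if_neg (by omega), add_zero]

theorem val_spell_lt_iff {L : List (Fin n × ℝ≥0)} (hL : L.Pairwise fun x y => x.1 ≤ y.1) {t : ℝ}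
    (h0 : 0 ≤ t) (h1 : t < (spell L).length) (c : ℕ) : (spell L).val t < c ↔ t < cumList L c := by
  induction L generalizing t with
  | nil => exact absurd (h0.trans_lt h1) (lt_irrefl _)
  | cons x L ih =>
    rw [List.pairwise_cons] at hL
    rw [spell_cons, length_mul, length_seg] at h1
    have hnn := (isCum_cumList L).nonneg c
    have hz : ¬ (x.1 : ℕ) < c → cumList L c = 0 := fun hc =>
      cumList_eq_zero fun y hy => (not_lt.1 hc).trans (hL.1 y hy)
    rw [spell_cons, val_mul, length_seg, cumList_cons]
    split_ifs with h h' h'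
    · rw [val_seg h0 h]
      exact iff_of_true h' (by linarith)
    · rw [val_seg h0 h, hz h']
      exact iff_of_false h' (by linarith)
    · rw [ih hL.2 (by linarith) (by linarith)]
      exact sub_lt_iff_lt_add'
    · rw [ih hL.2 (by linarith) (by linarith), hz h']
      exact iff_of_false (by linarith) (by linarith)

theorem exists_row_eq {u : TimedWord n} (hu : u.IsRow) : ∃ P, IsCum P ∧ row n P = u := by
  obtain ⟨L, rfl, hL⟩ := exists_spell_pos u
  have hP := isCum_cumList L
  refine ⟨cumList L, hP, ext_of_val ?_ fun t h0 h1 => ?_⟩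
  · rw [length_row hP, cumList_eq_length]
  · have h1' : t < cumList L n := by rwa [cumList_eq_length]
    have key : ∀ c ≤ n, (row n (cumList L)).val t < c ↔ (spell L).val t < c := fun c hc => by
      rw [val_row_lt_iff hP h0 h1' hc, val_spell_lt_iff (pairwise_of_isRow hL hu) h0 h1]
    have hn := (val_row_lt_iff hP h0 h1' le_rfl).2 h1'
    have hn' := (key n le_rfl).1 hn
    have h2 := (key _ hn).1 (Nat.lt_succ_self _)
    have h3 := (key _ hn').2 (Nat.lt_succ_self _)
    omega

/-- The product `u_{N-1} ⋯ u_1 u_0`. -/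
noncomputable def downProd (u : ℕ → TimedWord n) : ℕ → TimedWord n
  | 0 => 1
  | N + 1 => u N * downProd u N

theorem downProd_succ (u : ℕ → TimedWord n) (N : ℕ) : downProd u (N + 1) = u N * downProd u N :=
  rfl

theorem downProd_congr {u v : ℕ → TimedWord n} {N : ℕ} (h : ∀ i < N, u i = v i) :
    downProd u N = downProd v N := by
  induction N with
  | zero => rfl
  | succ N ih => rw [downProd_succ, downProd_succ, ih fun i hi => h i (by omega), h N (by omega)]

theorem prod_reverse_eq_downProd (K : List (TimedWord n)) (N : ℕ) (hN : K.length ≤ N) :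
    K.reverse.prod = downProd (fun i => K.getD i 1) N := by
  induction N, hN using Nat.le_induction with
  | base =>
    induction K using List.reverseRecOn with
    | nil => rfl
    | append_singleton K x ih =>
      rw [List.length_append, List.length_singleton, downProd_succ, List.reverse_append,
        List.reverse_singleton, List.singleton_append, List.prod_cons, ih]
      congr 1
      · simp
      · refine downProd_congr fun i hi => ?_
        rw [List.getD_append _ _ _ _ hi]
  | succ N hN ih => rw [downProd_succ, List.getD_eq_default _ _ hN, one_mul, ih]

theorem dominatedBy_one (u : TimedWord n) : u.DominatedBy 1 :=
  dominatedBy_iff.2 ⟨u.length_nonneg, fun _ h0 h1 => absurd (h0.trans_lt h1) (lt_irrefl _)⟩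

/-- A sequence of cumulative functions describing a tableau with rows `p 0, p 1, …`, from the
bottom. -/
structure IsTab (n : ℕ) (p : ℕ → ℕ → ℝ) : Prop where
  cum : ∀ i, IsCum (p i)
  dom : ∀ i, ∀ c < n, p (i + 1) (c + 1) ≤ p i c

/-- Empty rows are added on top without end, so that two tableaux can be compared with the same
number of rows. -/
theorem IsTableau.exists_isTab {w : TimedWord n} (hw : w.IsTableau) :
    ∃ p N, IsTab n p ∧ ∀ M, N ≤ M → downProd (fun i => row n (p i)) M = w := by
  obtain ⟨L, ⟨hprod, hrow, -⟩, hL⟩ := hw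
  have hu : ∀ i, ((L.reverse).getD i 1).IsRow := by
    intro i
    by_cases hi : i < L.reverse.length
    · rw [List.getD_eq_getElem _ _ hi]
      exact (hrow _ (List.mem_reverse.1 (List.getElem_mem hi))).1
    · rw [List.getD_eq_default _ _ (not_lt.1 hi)]
      exact isRow_one
  have hdom : ∀ i, (L.reverse.getD i 1).DominatedBy (L.reverse.getD (i + 1) 1) := by
    intro i
    by_cases hi : i + 1 < L.reverse.length
    · rw [List.getD_eq_getElem _ _ hi, List.getD_eq_getElem _ _ (by omega)]
      exact List.isChain_iff_getElem.1 (List.isChain_reverse.2 hL) i hi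
    · rw [List.getD_eq_default _ 1 (not_lt.1 hi)]
      exact dominatedBy_one _
  choose p hp hpu using fun i => exists_row_eq (hu i)
  refine ⟨p, L.length, ⟨hp, fun i => ?_⟩, fun M hM => ?_⟩
  · rw [← dominatedBy_row_iff (hp i) (hp (i + 1)), hpu, hpu]
    exact hdom i
  · simp only [hpu]
    rw [← prod_reverse_eq_downProd _ _ (by simpa using hM), List.reverse_reverse, hprod]

end TimedWord

/-! ### Greene's theorem for tableaux. -/

namespace TimedWord

open ChainOp MeasureTheory Function

variable {n : ℕ} {k m : ℕ}

theorem chainHom_mul_apply (u v : TimedWord n) (F : ChainFun k) :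
    chainHom k m (u * v) F = chainHom k m u (chainHom k m v F) := by
  rw [map_mul]
  rfl

theorem le_chainHom (w : TimedWord n) (F : ChainFun k) : F.1 ≤ (chainHom k m w F).1 := by
  obtain ⟨L, rfl⟩ := exists_spell w
  rw [chainHom_spell]
  induction trunc m L with
  | nil => exact le_rfl
  | cons x L ih => exact fun v => (ih v).trans le_opA

theorem chainHom_segN_of_lt {a : ℕ} (ha : a < n) (ham : a < m) (s : ℝ) (F : ChainFun k) :
    (chainHom k m (segN n a s) F).1 = opA a s.toNNReal F.1 := by
  rw [segN_of_lt ha, chainHom_seg, letterOp_of_lt ham]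

theorem chainHom_segN_of_ge {a : ℕ} (ham : m ≤ a) (s : ℝ) (F : ChainFun k) :
    chainHom k m (segN n a s) F = F := by
  by_cases ha : a < n
  · rw [segN_of_lt ha, chainHom_seg, letterOp_of_not_lt (by simpa using ham)]
  · rw [segN_of_not_lt ha, map_one]
    rfl

theorem chainHom_rowPart_of_ge {P : ℕ → ℝ} {i : ℕ} (hi : m ≤ i) (d : ℕ) (F : ChainFun k) :
    chainHom k m (rowPart n P i d) F = F := by
  induction d with
  | zero =>
    rw [rowPart, map_one]
    rfl
  | succ d ih => rw [rowPart_succ, chainHom_mul_apply, chainHom_segN_of_ge (by omega), ih]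

theorem chainHom_row {P : ℕ → ℝ} (hm : m ≤ n) (F : ChainFun k) :
    chainHom k m (row n P) F = chainHom k m (rowPart n P 0 m) F := by
  obtain ⟨e, he⟩ := exists_add_of_le hm
  have := rowPart_add (n := n) P 0 m e
  rw [← he] at this
  rw [row, this, chainHom_mul_apply, chainHom_rowPart_of_ge (i := 0 + m) (by omega)]

/-- Chain `i` takes every letter of the row part. -/
theorem le_chainHom_rowPart {P : ℕ → ℝ} (hP : IsCum P) (hm : m ≤ n) {d : ℕ} (hd : d ≤ m)
    (F : ChainFun k) (v : Fin k → ℕ) (i : Fin k) (hi : v i = 0) :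
    ENNReal.ofReal (P d) + F.1 (update v i d) ≤ (chainHom k m (rowPart n P 0 d) F).1 v := by
  induction d generalizing F with
  | zero =>
    rw [hP.zero, ENNReal.ofReal_zero, zero_add, ← hi, update_eq_self]
    exact le_chainHom _ _ _
  | succ d ih =>
    rw [rowPart_succ, chainHom_mul_apply]
    refine le_trans ?_ (ih (by omega) _)
    rw [zero_add, chainHom_segN_of_lt (by omega) (by omega)]
    have h1 := add_le_opA (F := F.1) (s := (P (d + 1) - P d).toNNReal) (i := i) (a := d)
      (v := update v i d) (by simp)
    rw [update_idem] at h1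
    refine le_trans ?_ (add_le_add_right h1 _)
    rw [← add_assoc]
    refine add_le_add ?_ (F.2.anti (update_le_update_iff.2 ⟨by simp, fun _ _ => le_rfl⟩))
    change _ ≤ ENNReal.ofReal (P d) + ENNReal.ofReal (P (d + 1) - P d)
    rw [← ENNReal.ofReal_add (hP.nonneg d) (hP.sub_nonneg d)]
    exact ENNReal.ofReal_le_ofReal (by linarith)

/-- The lower bound: chain `i` follows row `i`, and the rows with index at least `k` are skipped. -/
theorem le_chainHom_downProd {p : ℕ → ℕ → ℝ} (hp : ∀ i, IsCum (p i)) (hm : m ≤ n) (N : ℕ)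
    (F : ChainFun k) (v : Fin k → ℕ) (hv : ∀ i : Fin k, (i : ℕ) < N → v i = 0) :
    ∑ i ∈ Finset.range (min k N), ENNReal.ofReal (p i m) ≤
      (chainHom k m (downProd (fun i => row n (p i)) N) F).1 v := by
  induction N generalizing v with
  | zero => simp
  | succ N ih =>
    rw [downProd_succ, chainHom_mul_apply]
    rcases Nat.lt_or_ge N k with h | h
    · rw [chainHom_row hm]
      refine le_trans ?_ (le_chainHom_rowPart (hp N) hm le_rfl _ v ⟨N, h⟩ (hv _ (by simp)))
      rw [min_eq_right h, Finset.sum_range_succ, add_comm]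
      refine add_le_add_right ?_ _
      have := ih (update v ⟨N, h⟩ m) fun i hi => by
        rw [update_of_ne (by rintro rfl; simp at hi)]
        exact hv i (by omega)
      rwa [min_eq_right h.le] at this
    · refine le_trans ?_ (le_chainHom _ _ _)
      have := ih v fun i hi => hv i (by omega)
      rw [min_eq_left h] at this
      rw [min_eq_left (by omega)]
      exact this

/-- The upper bound for the total length of a family of chains which visit each column `t` in
letters of a decreasing sequence of length `h t` with greatest element `τ t`. -/
noncomputable def potential (h τ : ℝ → ℕ) (v : Fin k → ℕ) : ℝ≥0∞ :=
  ∫⁻ t, ((min (h t) (Finset.univ.filter fun j => v j ≤ τ t).card : ℕ) : ℝ≥0∞)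

-- Placing `a` on top of the columns over `[p, q)` raises their height by one. A chain that takes
-- `a` cannot visit the letters below it in these columns, so it is counted once there.
open Classical in
theorem opA_potential_le {h τ : ℝ → ℕ} {a : ℕ} {p q : ℝ}
    (hτ : ∀ t ∈ Set.Ico p q, h t = 0 ∨ τ t < a) (v : Fin k → ℕ) :
    opA a (q - p).toNNReal (potential h τ) v ≤
      potential (fun t => if t ∈ Set.Ico p q then h t + 1 else h t)
        (fun t => if t ∈ Set.Ico p q then a else τ t) v := by
  refine opA_le.2 ⟨lintegral_mono fun t => ?_, fun i hi => ?_⟩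
  · beta_reduce
    split_ifs with ht
    · norm_cast
      rcases hτ t ht with h0 | h0
      · simp [h0]
      · refine min_le_min (Nat.le_succ _) (Finset.card_le_card fun j hj => ?_)
        simp only [Finset.mem_filter, Finset.mem_univ, true_and] at hj ⊢
        omega
    · exact le_rfl
  · have hs : ((q - p).toNNReal : ℝ≥0∞) = ∫⁻ t, (Set.Ico p q).indicator 1 t := by
      rw [lintegral_indicator_one measurableSet_Ico, Real.volume_Ico]
      rfl
    rw [potential, hs, ← lintegral_add_left (measurable_one.indicator measurableSet_Ico)]
    refine lintegral_mono fun t => ?_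
    by_cases ht : t ∈ Set.Ico p q
    · simp only [Set.indicator_of_mem ht, Pi.one_apply, if_pos ht]
      norm_cast
      have hmem : i ∈ Finset.univ.filter fun j => v j ≤ a := by simpa using hi
      rcases hτ t ht with h0 | h0
      · rw [h0]
        simp only [zero_le, inf_of_le_left, add_zero, zero_add]
        exact le_min le_rfl (Finset.card_pos.2 ⟨i, hmem⟩)
      · rw [add_comm, ← min_add_add_right]
        refine min_le_min le_rfl ?_
        rw [← Finset.card_erase_add_one hmem]
        refine Nat.add_le_add_right (Finset.card_le_card fun j hj => ?_) _
        simp only [Finset.mem_filter, Finset.mem_univ, true_and, Finset.mem_erase] at hj ⊢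
        -- Chain `i` now stands at `a`, above the former top `τ t`, so it is not among the chains
        -- that can still visit column `t`.
        have hji : j ≠ i := by
          rintro rfl
          rw [update_self] at hj
          omega
        rw [update_of_ne hji] at hj
        exact ⟨hji, by omega⟩
    · simp only [Set.indicator_of_notMem ht, if_neg ht, zero_add]
      norm_cast
      refine min_le_min le_rfl (Finset.card_le_card fun j hj => ?_)
      simp only [Finset.mem_filter, Finset.mem_univ, true_and] at hj ⊢
      by_cases hji : j = i
      · subst hji
        rw [update_self] at hj
        omega
      · rwa [update_of_ne hji] at hj

-- The operator of the largest letter is applied first; the cells of different letters are disjoint,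
-- so each column receives at most one new letter.
open Classical in
theorem chainHom_rowPart_le_potential {P : ℕ → ℝ} (hP : IsCum P) (hm : m ≤ n) {d : ℕ} (hd : d ≤ m)
    (F : ChainFun k) (h τ : ℝ → ℕ) (hF : F.1 ≤ potential h τ)
    (hτ : ∀ c < d, ∀ t ∈ Set.Ico (P c) (P (c + 1)), h t = 0 ∨ τ t < c) :
    ∃ τ' : ℝ → ℕ, (∀ c < d, ∀ t ∈ Set.Ico (P c) (P (c + 1)), τ' t = c) ∧
      (∀ t, P d ≤ t → τ' t = τ t) ∧ (chainHom k m (rowPart n P 0 d) F).1 ≤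
        potential (fun t => if t ∈ Set.Ico 0 (P d) then h t + 1 else h t) τ' := by
  induction d generalizing F h τ with
  | zero =>
    refine ⟨τ, by simp, fun _ _ => rfl, ?_⟩
    simp only [rowPart, map_one, hP.zero, Set.Ico_self, Set.mem_empty_iff_false, if_false]
    exact hF
  | succ d ih =>
    have h0 := hP.nonneg d
    have h1 := hP.sub_nonneg d
    obtain ⟨τ', h2, h3, h4⟩ := ih (by omega) (chainHom k m (segN n d (P (d + 1) - P d)) F)
      (fun t => if t ∈ Set.Ico (P d) (P (d + 1)) then h t + 1 else h t)
      (fun t => if t ∈ Set.Ico (P d) (P (d + 1)) then d else τ t)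
      (by
        rw [chainHom_segN_of_lt (by omega) (by omega)]
        exact (opA_mono hF).trans (opA_potential_le (hτ d (by omega))))
      (fun c hc t ht => by
        have : t ∉ Set.Ico (P d) (P (d + 1)) := fun h' =>
          absurd (ht.2.trans_le (hP.mono hc)) (not_lt.2 h'.1)
        rw [if_neg this, if_neg this]
        exact hτ c (by omega) t ht)
    refine ⟨τ', fun c hc t ht => ?_, fun t ht => ?_, ?_⟩
    · rcases Nat.lt_or_ge c d with h' | h'
      · exact h2 c h' t ht
      · obtain rfl : c = d := by omega
        rw [h3 t ht.1, if_pos ht]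
    · rw [h3 t (by linarith), if_neg fun h' => absurd h'.2 (not_lt.2 ht)]
    · rw [rowPart_succ, chainHom_mul_apply, zero_add]
      refine h4.trans (le_of_eq ?_)
      congr 1
      funext t
      by_cases ht : t ∈ Set.Ico (P d) (P (d + 1))
      · rw [if_pos ht, if_neg fun h' => absurd h'.2 (not_lt.2 ht.1), if_pos ⟨h0.trans ht.1, ht.2⟩]
      · rw [if_neg ht]
        refine if_congr ⟨fun h' => ⟨h'.1, by linarith [h'.2]⟩, fun h' => ⟨h'.1, ?_⟩⟩ rfl rfl
        by_contra h''
        exact ht ⟨not_lt.1 h'', h'.2⟩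

theorem exists_between_of_lt {P : ℕ → ℝ} (hP : IsCum P) {t : ℝ} (h0 : 0 ≤ t) {c : ℕ}
    (h : t < P c) : ∃ b < c, t ∈ Set.Ico (P b) (P (b + 1)) := by
  induction c with
  | zero => rw [hP.zero] at h; linarith
  | succ c ih =>
    by_cases h' : t < P c
    · obtain ⟨b, hb, hb'⟩ := ih h'
      exact ⟨b, by omega, hb'⟩
    · exact ⟨c, by omega, not_lt.1 h', h⟩

-- The upper bound, built row by row from the bottom. The invariant says that the current tops lie
-- strictly below the letters of the next row; with no rows yet, `τ` is arbitrary and the height is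
-- zero.
open Classical in
theorem chainHom_downProd_le_potential {p : ℕ → ℕ → ℝ} (hp : IsTab n p) (hm : m ≤ n) (N : ℕ) :
    ∃ τ : ℝ → ℕ, (∀ c < m, ∀ t ∈ Set.Ico (p N c) (p N (c + 1)), N = 0 ∨ τ t < c) ∧
      (chainHom k m (downProd (fun i => row n (p i)) N) ⟨0, Good.zero⟩).1 ≤
        potential (fun t => ((Finset.range N).filter fun i => t ∈ Set.Ico 0 (p i m)).card) τ := by
  induction N with
  | zero =>
    refine ⟨fun _ => 0, by simp, ?_⟩
    rw [downProd, map_one]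
    exact fun v => bot_le
  | succ N ih =>
    obtain ⟨τ, h1, h2⟩ := ih
    obtain ⟨τ', h3, -, h4⟩ := chainHom_rowPart_le_potential (hp.cum N) hm le_rfl _ _ τ h2
      (fun c hc t ht => (h1 c hc t ht).imp_left (by rintro rfl; simp))
    refine ⟨τ', fun c hc t ht => ?_, ?_⟩
    · obtain ⟨b, hb, hb'⟩ := exists_between_of_lt (hp.cum N)
        (((hp.cum (N + 1)).nonneg c).trans ht.1) (ht.2.trans_le (hp.dom N c (by omega)))
      rw [h3 b (by omega) t hb']
      exact Or.inr hb
    · rw [downProd_succ, chainHom_mul_apply, chainHom_row hm]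
      refine h4.trans (le_of_eq ?_)
      congr 1
      funext t
      rw [Finset.range_add_one, Finset.filter_insert]
      split_ifs <;> simp

theorem IsTab.antitone {p : ℕ → ℕ → ℝ} (hp : IsTab n p) (hm : m ≤ n) :
    Antitone fun i => p i m := by
  refine antitone_nat_of_succ_le fun i => ?_
  rcases m with _ | m
  · rw [(hp.cum i).zero, (hp.cum (i + 1)).zero]
  · exact (hp.dom i m (by omega)).trans ((hp.cum i).mono (by omega))

/-- Greene's theorem for timed tableaux. -/
theorem chainMax_downProd {p : ℕ → ℕ → ℝ} (hp : IsTab n p) (hm : m ≤ n) {N : ℕ} (hk : k ≤ N) :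
    chainMax k m (downProd (fun i => row n (p i)) N) =
      ∑ i ∈ Finset.range k, ENNReal.ofReal (p i m) := by
  classical
  refine le_antisymm ?_ ?_
  · obtain ⟨τ, -, h⟩ := chainHom_downProd_le_potential (k := k) hp hm N
    refine (h 0).trans ?_
    have h1 : ∀ i, ENNReal.ofReal (p i m) =
        ∫⁻ t, (Set.Ico 0 (p i m)).indicator (1 : ℝ → ℝ≥0∞) t := by
      intro i
      rw [lintegral_indicator_one measurableSet_Ico, Real.volume_Ico, sub_zero]
    rw [Finset.sum_congr rfl fun i _ => h1 i, ← lintegral_finsetSum _ fun i _ =>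
      measurable_one.indicator measurableSet_Ico]
    refine lintegral_mono fun t => ?_
    have h2 : ∑ i ∈ Finset.range k, (Set.Ico 0 (p i m)).indicator (1 : ℝ → ℝ≥0∞) t =
        (((Finset.range k).filter fun i => t ∈ Set.Ico 0 (p i m)).card : ℝ≥0∞) := by
      simp [Set.indicator_apply]
    rw [h2]
    beta_reduce
    rw [Nat.cast_le]
    -- Either the lowest `k` rows all reach column `t`, and the number of chains is the bound, or
    -- the column has height below `k`, since row lengths decrease upwards.
    by_cases hall : ∀ i < k, t ∈ Set.Ico 0 (p i m)
    · rw [Finset.filter_true_of_mem fun i hi => hall i (Finset.mem_range.1 hi), Finset.card_range]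
      refine (min_le_right _ _).trans ((Finset.card_le_univ _).trans (by simp))
    · push Not at hall
      obtain ⟨j, hj, hj'⟩ := hall
      refine (min_le_left _ _).trans (Finset.card_le_card fun i hi => ?_)
      simp only [Finset.mem_filter, Finset.mem_range] at hi ⊢
      refine ⟨?_, hi.2⟩
      by_contra hik
      exact hj' ⟨hi.2.1, hi.2.2.trans_le (hp.antitone hm (by omega))⟩
  · have := le_chainHom_downProd (k := k) hp.cum hm N ⟨0, Good.zero⟩ 0 fun _ _ => rfl
    rwa [min_eq_left hk] at this

/-- The difference of the invariants for `i + 1` and `i` chains is the cumulative length `p i c`. -/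
theorem eq_of_isTableau_of_knuthCon {w w' : TimedWord n} (hw : w.IsTableau) (hw' : w'.IsTableau)
    (h : knuthCon n w w') : w = w' := by
  obtain ⟨p, N, hp, hN⟩ := hw.exists_isTab
  obtain ⟨p', N', hp', hN'⟩ := hw'.exists_isTab
  have h1 := hN (max N N') (le_max_left _ _)
  have h2 := hN' (max N N') (le_max_right _ _)
  rw [← h1, ← h2] at h ⊢
  refine downProd_congr fun i hi => rowPart_congr fun c _ hc => ?_
  rw [zero_add] at hc
  have key : ∀ k ≤ max N N', ∑ i ∈ Finset.range k, ENNReal.ofReal (p i c) =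
      ∑ i ∈ Finset.range k, ENNReal.ofReal (p' i c) := fun k hk => by
    rw [← chainMax_downProd hp hc hk, ← chainMax_downProd hp' hc hk,
      chainMax_eq_of_knuthCon h]
  have h3 := key (i + 1) hi
  rw [Finset.sum_range_succ, Finset.sum_range_succ, key i hi.le] at h3
  have h4 := (ENNReal.add_right_inj (by simp [ENNReal.sum_eq_top])).1 h3
  exact (ENNReal.ofReal_eq_ofReal_iff ((hp.cum i).nonneg c) ((hp'.cum i).nonneg c)).1 h4

end TimedWord

/-! ### Insertion of a letter into a row. -/

namespace TimedWord

variable {n : ℕ}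

theorem rowPart_congr_sub {P Q : ℕ → ℝ} {i d : ℕ}
    (h : ∀ c, i ≤ c → c < i + d → P (c + 1) - P c = Q (c + 1) - Q c) :
    rowPart n P i d = rowPart n Q i d := by
  induction d with
  | zero => rfl
  | succ d ih =>
    rw [rowPart_succ, rowPart_succ, ih fun c h1 h2 => h c h1 (by omega), h _ (by omega) (by omega)]

theorem rowPart_eq_one {P : ℕ → ℝ} (hP : Monotone P) {i d : ℕ} (hd : i + d ≤ n)
    (h : P (i + d) = P i) : rowPart n P i d = 1 :=
  eq_one_of_length_eq_zero (by rw [length_rowPart hP hd, h, sub_self])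

/-- The row obtained by inserting the letter `a` with duration `s`. -/
noncomputable def insLetter (P : ℕ → ℝ) (a : ℕ) (s : ℝ) (c : ℕ) : ℝ :=
  if c ≤ a then P c else max (P c) (P (a + 1) + s)

/-- The row bumped by inserting the letter `a` with duration `s`. -/
noncomputable def bumpLetter (P : ℕ → ℝ) (a : ℕ) (s : ℝ) (c : ℕ) : ℝ :=
  if c ≤ a then 0 else min (P c) (P (a + 1) + s) - P (a + 1)

section

variable {P Q : ℕ → ℝ} {a : ℕ} {s : ℝ}

theorem IsCum.insLetter (hP : IsCum P) (a : ℕ) (s : ℝ) : IsCum (insLetter P a s) where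
  zero := by simp [TimedWord.insLetter, hP.zero]
  mono c d hcd := by
    have h1 := hP.mono hcd
    unfold TimedWord.insLetter
    split_ifs with h h' h'
    · exact h1
    · exact h1.trans (le_max_left _ _)
    · omega
    · exact max_le_max h1 le_rfl

theorem IsCum.bumpLetter (hP : IsCum P) (a : ℕ) (hs : 0 ≤ s) : IsCum (bumpLetter P a s) where
  zero := by simp [TimedWord.bumpLetter]
  mono c d hcd := by
    have h1 := hP.mono hcd
    unfold TimedWord.bumpLetter
    split_ifs with h h' h'
    · exact le_rfl
    · have := hP.mono (show a + 1 ≤ d by omega)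
      exact _root_.sub_nonneg.2 (le_min this (by linarith))
    · omega
    · exact sub_le_sub_right (min_le_min h1 le_rfl) _

theorem bumpLetter_of_le {c : ℕ} (hs : 0 ≤ s) (hc : c ≤ a + 1) : bumpLetter P a s c = 0 := by
  unfold bumpLetter
  split_ifs with h
  · rfl
  · obtain rfl : c = a + 1 := by omega
    rw [min_eq_left (by linarith), sub_self]

theorem bumpLetter_of_lt {c : ℕ} (hc : a < c) :
    bumpLetter P a s c = min (P c) (P (a + 1) + s) - P (a + 1) := if_neg (not_le.2 hc)

theorem insLetter_of_lt {c : ℕ} (hc : a < c) :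
    insLetter P a s c = max (P c) (P (a + 1) + s) := if_neg (not_le.2 hc)

theorem insLetter_of_le {c : ℕ} (hc : c ≤ a) : insLetter P a s c = P c := if_pos hc

/-- The letters above `a` occupy times from `P (a + 1)` on; cutting at `P (a + 1) + s` gives the
bumped part and then the remaining part. -/
theorem rowPart_eq_mul (hP : IsCum P) (hs : 0 ≤ s) {d : ℕ} (hd : a + 1 + d ≤ n) :
    rowPart n P (a + 1) d =
      rowPart n (bumpLetter P a s) (a + 1) d * rowPart n (insLetter P a s) (a + 1) d := by
  induction d with
  | zero => simp [rowPart]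
  | succ d ih =>
    have hV := hP.bumpLetter a hs
    have hI := hP.insLetter a s
    have hsum : P (a + 1 + d + 1) - P (a + 1 + d) =
        (bumpLetter P a s (a + 1 + d + 1) - bumpLetter P a s (a + 1 + d)) +
        (insLetter P a s (a + 1 + d + 1) - insLetter P a s (a + 1 + d)) := by
      rw [bumpLetter_of_lt (by omega), bumpLetter_of_lt (by omega), insLetter_of_lt (by omega),
        insLetter_of_lt (by omega)]
      have h1 := min_add_max (P (a + 1 + d + 1)) (P (a + 1) + s)
      have h2 := min_add_max (P (a + 1 + d)) (P (a + 1) + s)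
      linarith
    rw [rowPart_succ, rowPart_succ, rowPart_succ, ih (by omega), hsum,
      segN_add _ (hV.sub_nonneg _) (hI.sub_nonneg _)]
    -- Beyond the cut the new letter adds nothing to the bumped part; before it the remaining part
    -- is still empty. In both cases the factors can be regrouped.
    rcases le_or_gt (P (a + 1) + s) (P (a + 1 + d)) with h | h
    · have h' := hP.mono (show a + 1 + d ≤ a + 1 + d + 1 by omega)
      rw [bumpLetter_of_lt (by omega), bumpLetter_of_lt (by omega), min_eq_right h,
        min_eq_right (h.trans h'), sub_self]
      simp [mul_assoc]
    · rw [rowPart_eq_one hI.mono (by omega)]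
      · simp [mul_assoc]
      · rw [insLetter_of_lt (by omega), insLetter_of_lt (by omega), max_eq_right h.le,
          max_eq_right (by linarith)]

theorem hasEndLimit_seg (a : Fin n) (s : ℝ≥0) : (seg a s).HasEndLimit a := tendsto_const_nhds

/-- Row insertion of a letter whose duration is that of the bumped row. -/
theorem knuthCon_bump {p q₁ q₂ : TimedWord n} {a : Fin n} {s : ℝ≥0} (hs : q₁.length = s)
    (hrow : (p * seg a s * (q₁ * q₂)).IsRow)
    (hlt : ∀ t, 0 ≤ t → t < q₁.length → (a : ℕ) < q₁.val t) :
    knuthCon n (p * (q₁ * q₂) * seg a s) (q₁ * (p * seg a s * q₂)) := by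
  rcases eq_zero_or_pos s with rfl | hpos
  · rw [eq_one_of_length_eq_zero hs]
    simp only [seg_zero, mul_one, one_mul]
    exact (knuthCon n).refl _
  have hpos' : 0 < q₁.length := hs ▸ hpos
  have hlt0 : a < q₁.toFun ⟨0, le_rfl, hpos'⟩ := by
    have := hlt 0 le_rfl hpos'
    rwa [val_eq ⟨le_rfl, hpos'⟩] at this
  obtain ⟨hpa, hq, -⟩ := isRow_of_mul hrow
  obtain ⟨hp, ha, -⟩ := isRow_of_mul hpa
  obtain ⟨hq1, hq2, -⟩ := isRow_of_mul hq
  -- The second relation brings `a` to the left across `q₂`, and then the first one brings `q₁` to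
  -- the left across `p`.
  have h2 : knuthCon n (q₁ * seg a s * q₂) (q₁ * q₂ * seg a s) :=
    ConGen.Rel.of _ _ (.kappa₂ (seg a s) q₁ q₂ ha hq1 hq2
      (by rw [mul_assoc]; rw [mul_assoc p] at hrow; exact (isRow_of_mul hrow).2.1)
      hs.symm hpos' a (hasEndLimit_seg a s) hlt0)
  have h1 : knuthCon n (p * q₁ * seg a s) (q₁ * p * seg a s) :=
    ConGen.Rel.of _ _ (.kappa₁ p (seg a s) q₁ hp ha hq1
      (by rw [← mul_assoc (p * seg a s)] at hrow; exact (isRow_of_mul hrow).1)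
      hs hpos' a (hasEndLimit_seg a s) hlt0)
  have h3 := (knuthCon n).trans
    ((knuthCon n).mul ((knuthCon n).refl p) ((knuthCon n).symm h2))
    (by
      have := (knuthCon n).mul h1 ((knuthCon n).refl q₂)
      rwa [show p * q₁ * seg a s * q₂ = p * (q₁ * seg a s * q₂) by simp only [mul_assoc]] at this)
  simpa only [mul_assoc] using h3

/-- The Knuth relations need equal lengths, so only the initial part of `a`, of the bumped duration
`V n ≤ s`, is used for bumping; the rest is simply appended. -/
theorem knuthCon_insLetter (hP : IsCum P) (hs : 0 ≤ s) (ha : a < n) :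
    knuthCon n (row n P * segN n a s) (row n (bumpLetter P a s) * row n (insLetter P a s)) := by
  obtain ⟨e, he⟩ := exists_add_of_le (show a + 1 ≤ n from ha)
  have hV := hP.bumpLetter a hs
  have hI := hP.insLetter a s
  set V := bumpLetter P a s with hVdef
  set I := insLetter P a s with hIdef
  have split : ∀ R : ℕ → ℝ, row n R = rowPart n R 0 (a + 1) * rowPart n R (a + 1) e := fun R => by
    have := rowPart_add (n := n) R 0 (a + 1) e
    rwa [← he, zero_add] at this
  have hVrow : row n V = rowPart n V (a + 1) e := by
    rw [split V, rowPart_eq_one hV.mono (by omega), one_mul]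
    rw [zero_add, hV.zero]
    exact bumpLetter_of_le hs le_rfl
  have hVn : V n = min (P n) (P (a + 1) + s) - P (a + 1) := bumpLetter_of_lt ha
  have hVn0 : 0 ≤ V n := hV.nonneg n
  have hVs : V n ≤ s := by
    rw [hVn]
    linarith [min_le_right (P n) (P (a + 1) + s)]
  have hIrow : row n I =
      rowPart n P 0 (a + 1) * segN n a s * rowPart n I (a + 1) e := by
    have h1 : I (a + 1) = P (a + 1) + s := by
      rw [hIdef, insLetter_of_lt (Nat.lt_succ_self a), max_eq_right (by linarith)]
    have h2 : I a = P a := insLetter_of_le le_rfl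
    rw [split I, rowPart_succ, rowPart_succ, zero_add, h1, h2,
      show P (a + 1) + s - P a = (P (a + 1) - P a) + s by ring, segN_add _ (hP.sub_nonneg a) hs]
    rw [rowPart_congr (n := n) (P := I) (Q := P) fun c _ hc => insLetter_of_le (by omega)]
    simp only [mul_assoc]
  have hq : rowPart n P (a + 1) e = rowPart n V (a + 1) e * rowPart n I (a + 1) e :=
    rowPart_eq_mul hP hs (by omega)
  -- The row `P` with an extra stretch of `a` of length `V n`, which supplies the monotonicity
  -- condition of `knuthCon_bump`.
  have hext : IsCum fun c => if c ≤ a then P c else P c + V n := by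
    refine ⟨by simp [hP.zero], fun c d hcd => ?_⟩
    have := hP.mono hcd
    split_ifs
    · exact this
    · linarith
    · omega
    · linarith
  have hrow : (rowPart n P 0 (a + 1) * segN n a (V n) *
      (rowPart n V (a + 1) e * rowPart n I (a + 1) e)).IsRow := by
    have := isRow_row (n := n) hext
    rw [split, rowPart_succ, zero_add] at this
    rw [if_neg (by omega), if_pos le_rfl,
      show P (a + 1) + V n - P a = (P (a + 1) - P a) + V n by ring,
      segN_add _ (hP.sub_nonneg a) hVn0,
      rowPart_congr (n := n) (i := 0) (Q := P) fun c _ hc => if_pos (by omega),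
      rowPart_congr_sub (n := n) (i := a + 1) (Q := P) fun c h1 h2 => by
        rw [if_neg (by omega), if_neg (by omega)]; ring] at this
    rw [← hq, rowPart_succ, zero_add]
    rwa [mul_assoc (rowPart n P 0 a)]
  have hlen : (rowPart n V (a + 1) e).length = ((V n).toNNReal : ℝ) := by
    rw [← hVrow, length_row hV, Real.coe_toNNReal _ hVn0]
  have key := knuthCon_bump (p := rowPart n P 0 (a + 1)) (q₁ := rowPart n V (a + 1) e)
    (q₂ := rowPart n I (a + 1) e) (a := ⟨a, ha⟩) (s := (V n).toNNReal) hlen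
    (by rwa [← segN_of_lt ha]) fun t h0 h1 => by
      rw [← hVrow] at h1 ⊢
      rw [length_row hV] at h1
      have := (val_row_lt_iff hV h0 h1 (show a + 1 ≤ n from ha)).not.2 (by
        rw [hVdef, bumpLetter_of_le hs le_rfl]
        linarith)
      simpa using this
  rw [← segN_of_lt ha, ← hq, ← split P, ← hVrow] at key
  have hs' : segN n a s = segN n a (V n) * segN n a (s - V n) := by
    rw [← segN_add _ hVn0 (by linarith)]
    congr 1
    ring
  -- One of the two factors is empty: either the full duration `s` is bumped, or every letter above
  -- `a` is.
  have hcomm : rowPart n I (a + 1) e * segN n a (s - V n) =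
      segN n a (s - V n) * rowPart n I (a + 1) e := by
    rcases le_or_gt (P (a + 1) + s) (P n) with h | h
    · rw [hVn, min_eq_right h, show s - (P (a + 1) + s - P (a + 1)) = 0 by ring]
      simp
    · rw [rowPart_eq_one hI.mono (by omega)]
      · simp
      · have := hP.mono (show a + 1 ≤ n from ha)
        rw [← he, hIdef, insLetter_of_lt ha, insLetter_of_lt (Nat.lt_succ_self a),
          max_eq_right h.le, max_eq_right (by linarith)]
  have := (knuthCon n).mul key ((knuthCon n).refl (segN n a (s - V n)))
  rw [hIrow, hs']
  simpa only [mul_assoc, hcomm] using this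

end

/-! ### Insertion of words into tableaux. -/

/-- The word spelled by a list of letters with durations. -/
noncomputable def spellN (n : ℕ) (W : List (ℕ × ℝ)) : TimedWord n :=
  (W.map fun x => segN n x.1 x.2).prod

/-- The letters of the row described by `V`. -/
def rowList (n : ℕ) (V : ℕ → ℝ) : List (ℕ × ℝ) :=
  (List.range n).map fun b => (b, V (b + 1) - V b)

theorem spellN_rowList (V : ℕ → ℝ) : spellN n (rowList n V) = row n V := by
  have : ∀ d, ((List.range d).map fun b => segN n b (V (b + 1) - V b)).prod =
      rowPart n V 0 d := by
    intro d
    induction d with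
    | zero => rfl
    | succ d ih => simp [List.range_succ, ih, rowPart_succ]
  rw [spellN, rowList, List.map_map, row, ← this]
  rfl

/-- The row obtained by inserting a word. -/
noncomputable def insWord (P : ℕ → ℝ) (W : List (ℕ × ℝ)) : ℕ → ℝ :=
  W.foldl (fun P x => insLetter P x.1 x.2) P

/-- The word bumped by inserting a word into a row. -/
noncomputable def bumpWord (n : ℕ) : (ℕ → ℝ) → List (ℕ × ℝ) → List (ℕ × ℝ)
  | _, [] => []
  | P, x :: W => rowList n (bumpLetter P x.1 x.2) ++ bumpWord n (insLetter P x.1 x.2) W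

/-- The letters are less than `n`, and those less than `k` have no duration. -/
def Valid (n k : ℕ) (W : List (ℕ × ℝ)) : Prop :=
  ∀ x ∈ W, 0 ≤ x.2 ∧ x.1 < n ∧ (x.1 < k → x.2 = 0)

theorem Valid.tail {k : ℕ} {x : ℕ × ℝ} {W} (h : Valid n k (x :: W)) : Valid n k W :=
  fun y hy => h y (by simp [hy])

theorem Valid.head {k : ℕ} {x : ℕ × ℝ} {W} (h : Valid n k (x :: W)) :
    0 ≤ x.2 ∧ x.1 < n ∧ (x.1 < k → x.2 = 0) := h x (by simp)

theorem IsCum.insWord {P : ℕ → ℝ} (hP : IsCum P) {k : ℕ} {W : List (ℕ × ℝ)} (hW : Valid n k W) :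
    IsCum (insWord P W) := by
  induction W generalizing P with
  | nil => exact hP
  | cons x W ih => exact ih (hP.insLetter x.1 x.2) hW.tail

theorem knuthCon_insWord {P : ℕ → ℝ} (hP : IsCum P) {k : ℕ} {W : List (ℕ × ℝ)}
    (hW : Valid n k W) : knuthCon n (row n P * spellN n W)
      (spellN n (bumpWord n P W) * row n (insWord P W)) := by
  induction W generalizing P with
  | nil =>
    simp only [spellN, bumpWord, List.map_nil, List.prod_nil, mul_one, one_mul]
    exact (knuthCon n).refl _
  | cons x W ih =>
    have h1 := (knuthCon n).mul (knuthCon_insLetter hP hW.head.1 hW.head.2.1)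
      ((knuthCon n).refl (spellN n W))
    have h2 := (knuthCon n).mul ((knuthCon n).refl (row n (bumpLetter P x.1 x.2)))
      (ih (hP.insLetter x.1 x.2) hW.tail)
    rw [mul_assoc] at h1
    rw [mul_assoc] at h1
    have h3 := (knuthCon n).trans h1 h2
    have e1 : spellN n (x :: W) = segN n x.1 x.2 * spellN n W := by simp [spellN]
    have e2 : spellN n (bumpWord n P (x :: W)) = row n (bumpLetter P x.1 x.2) *
        spellN n (bumpWord n (insLetter P x.1 x.2) W) := by
      rw [bumpWord, ← spellN_rowList]
      simp [spellN]
    rw [e1, e2, mul_assoc]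
    exact h3

/-- A letter bumps only strictly larger letters, and a letter without duration bumps nothing. -/
theorem Valid.bumpWord {P : ℕ → ℝ} (hP : IsCum P) {k : ℕ} {W : List (ℕ × ℝ)}
    (hW : Valid n k W) : Valid n (k + 1) (bumpWord n P W) := by
  induction W generalizing P with
  | nil => simp [TimedWord.bumpWord, Valid]
  | cons x W ih =>
    obtain ⟨h0, h1, h2⟩ := hW.head
    intro y hy
    rw [TimedWord.bumpWord, List.mem_append] at hy
    rcases hy with hy | hy
    · obtain ⟨b, hb, rfl⟩ := List.mem_map.1 hy
      refine ⟨(hP.bumpLetter x.1 h0).sub_nonneg b, List.mem_range.1 hb, fun hbk => ?_⟩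
      rcases Nat.lt_or_ge x.1 k with h | h
      · have : ∀ c, TimedWord.bumpLetter P x.1 x.2 c = 0 := by
          intro c
          rcases Nat.lt_or_ge x.1 c with hc | hc
          · rw [bumpLetter_of_lt hc, h2 h, add_zero, min_eq_right (hP.mono hc), sub_self]
          · exact bumpLetter_of_le h0 (by omega)
        simp [this]
      · simp only at hbk ⊢
        rw [bumpLetter_of_le h0 (by omega), bumpLetter_of_le h0 (by omega), sub_self]
    · exact ih (hP.insLetter x.1 x.2) hW.tail y hy

/-- Domination survives because each bumped letter enters the upper row no further right than the
place it left in the lower row. -/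
theorem insWord_rowList_le {P Q : ℕ → ℝ} (hP : IsCum P) {a : ℕ} {s : ℝ} (hs : 0 ≤ s)
    (h : ∀ c < n, Q (c + 1) ≤ P c) :
    ∀ c < n, insWord Q (rowList n (bumpLetter P a s)) (c + 1) ≤ insLetter P a s c := by
  have hV := hP.bumpLetter a hs
  set V := bumpLetter P a s with hVdef
  -- After the bumped letters below `d` are inserted above, the bound is that for `a` inserted below
  -- with the partial duration `V d`.
  have key : ∀ d ≤ n, ∀ c < n,
      insWord Q ((List.range d).map fun b => (b, V (b + 1) - V b)) (c + 1) ≤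
        if c ≤ a then P c else max (P c) (P (a + 1) + V d) := by
    intro d
    induction d with
    | zero =>
      intro _ c hc
      have := h c hc
      simp only [List.range_zero, List.map_nil, insWord, List.foldl_nil]
      split_ifs
      · exact this
      · exact this.trans (le_max_left _ _)
    | succ d ih =>
      intro hd c hc
      have ih := ih (by omega)
      rw [List.range_succ, List.map_append, List.map_singleton, insWord, List.foldl_append]
      change insLetter (insWord Q _) d (V (d + 1) - V d) (c + 1) ≤ _
      set R := insWord Q ((List.range d).map fun b => (b, V (b + 1) - V b))
      have hmono := hV.mono (Nat.le_succ d)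
      have hRc : R (c + 1) ≤ if c ≤ a then P c else max (P c) (P (a + 1) + V (d + 1)) := by
        refine (ih c hc).trans ?_
        split_ifs
        · exact le_rfl
        · exact max_le_max le_rfl (by linarith)
      rcases Nat.lt_or_ge c d with hcd | hcd
      · rw [insLetter_of_le (by omega)]
        exact hRc
      · rw [insLetter_of_lt (by omega)]
        refine max_le hRc ?_
        have hRd := ih d (by omega)
        have hPcd := hP.mono hcd
        by_cases hda : d ≤ a
        · rw [if_pos hda] at hRd
          have h0 : V (d + 1) = 0 := bumpLetter_of_le hs (by omega)
          have h1 : V d = 0 := bumpLetter_of_le hs (by omega)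
          rw [h0, h1]
          split_ifs
          · linarith
          · exact le_max_of_le_left (by linarith)
        · rw [if_neg hda] at hRd
          rw [if_neg (by omega)]
          have h0 : V (d + 1) = min (P (d + 1)) (P (a + 1) + s) - P (a + 1) :=
            bumpLetter_of_lt (by omega)
          have h1 : V d = min (P d) (P (a + 1) + s) - P (a + 1) := bumpLetter_of_lt (by omega)
          have h2 : R (d + 1) ≤ P d := hRd.trans (max_le le_rfl (by
            rw [h1]
            linarith [min_le_left (P d) (P (a + 1) + s)]))
          -- Either all letters in `(a, d)` were bumped and `P (a + 1) + V d = P d`, or the bumping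
          -- ended before `d` and `V` no longer grows.
          rcases le_total (P d) (P (a + 1) + s) with h3 | h3
          · rw [min_eq_left h3] at h1
            exact le_max_of_le_right (by linarith)
          · rw [min_eq_right h3] at h1
            rw [min_eq_right (h3.trans (hP.mono (Nat.le_succ d)))] at h0
            exact le_max_of_le_left (by linarith)
  intro c hc
  refine (key n le_rfl c hc).trans ?_
  unfold insLetter
  split_ifs
  · exact le_rfl
  · refine max_le_max le_rfl (add_le_add_right ?_ _)
    rw [hVdef]
    unfold bumpLetter
    split_ifs
    · exact hs
    · linarith [min_le_right (P n) (P (a + 1) + s)]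

theorem insWord_bumpWord_le {P Q : ℕ → ℝ} (hP : IsCum P) {k : ℕ} {W : List (ℕ × ℝ)}
    (hW : Valid n k W) (h : ∀ c < n, Q (c + 1) ≤ P c) :
    ∀ c < n, insWord Q (bumpWord n P W) (c + 1) ≤ insWord P W c := by
  induction W generalizing P Q with
  | nil => exact h
  | cons x W ih =>
    rw [bumpWord, insWord, List.foldl_append]
    exact ih (hP.insLetter x.1 x.2) hW.tail (insWord_rowList_le hP hW.head.1 h)

/-- The word which is inserted into row `i` when `W` is inserted into a tableau. -/
noncomputable def bumpSeq (n : ℕ) (p : ℕ → ℕ → ℝ) (W : List (ℕ × ℝ)) : ℕ → List (ℕ × ℝ)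
  | 0 => W
  | i + 1 => bumpWord n (p i) (bumpSeq n p W i)

theorem valid_bumpSeq {p : ℕ → ℕ → ℝ} (hp : ∀ i, IsCum (p i)) {W : List (ℕ × ℝ)}
    (hW : Valid n 0 W) (i : ℕ) : Valid n i (bumpSeq n p W i) := by
  induction i with
  | zero => exact hW
  | succ i ih => exact ih.bumpWord (hp i)

theorem spellN_eq_one {W : List (ℕ × ℝ)} (hW : Valid n n W) : spellN n W = 1 := by
  induction W with
  | nil => rfl
  | cons x W ih =>
    have := ih hW.tail
    rw [spellN] at this ⊢
    rw [List.map_cons, List.prod_cons, this, hW.head.2.2 hW.head.2.1, segN_zero, one_mul]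

theorem knuthCon_downProd {p : ℕ → ℕ → ℝ} (hp : ∀ i, IsCum (p i)) {W : List (ℕ × ℝ)}
    (hW : Valid n 0 W) (N : ℕ) :
    knuthCon n (downProd (fun i => row n (p i)) N * spellN n W)
      (spellN n (bumpSeq n p W N) *
        downProd (fun i => row n (insWord (p i) (bumpSeq n p W i))) N) := by
  induction N with
  | zero =>
    simp only [downProd, bumpSeq, one_mul, mul_one]
    exact (knuthCon n).refl _
  | succ N ih =>
    rw [downProd_succ, downProd_succ, mul_assoc, ← mul_assoc (spellN n _)]
    refine (knuthCon n).trans ((knuthCon n).mul ((knuthCon n).refl _) ih) ?_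
    rw [← mul_assoc]
    exact (knuthCon n).mul (knuthCon_insWord (hp N) (valid_bumpSeq hp hW N))
      ((knuthCon n).refl _)

theorem DominatedBy.trans {u v w : TimedWord n} (h : u.DominatedBy v) (h' : v.DominatedBy w) :
    u.DominatedBy w := by
  rw [dominatedBy_iff] at *
  exact ⟨h'.1.trans h.1, fun t h0 h1 => (h.2 t h0 (h1.trans_le h'.1)).trans (h'.2 t h0 h1)⟩

theorem not_isRow_mul {u v : TimedWord n} (hu : u ≠ 1) (h : v.DominatedBy u) :
    ¬ (u * v).IsRow := fun hr => by
  rw [dominatedBy_iff] at h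
  have h0 := length_pos hu
  have h1 := (isRow_of_mul hr).2.2 0 0 le_rfl h0 le_rfl (h0.trans_le h.1)
  have h2 := h.2 0 le_rfl h0
  omega

/-- Empty rows are deleted; since domination is transitive, neighbours in the remaining list still
dominate, and `not_isRow_mul` makes it a row decomposition. -/
theorem isTableau_downProd {u : ℕ → TimedWord n} (hu : ∀ i, (u i).IsRow)
    (h : ∀ i, (u i).DominatedBy (u (i + 1))) (N : ℕ) : (downProd u N).IsTableau := by
  classical
  have hlt : ∀ i j, i < j → (u i).DominatedBy (u j) := by
    intro i j hij
    induction j, hij using Nat.le_induction with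
    | base => exact h i
    | succ j hj ih => exact ih.trans (h j)
  have hprod : ∀ L : List (TimedWord n), (L.filter (· ≠ 1)).prod = L.prod := by
    intro L
    induction L with
    | nil => rfl
    | cons x L ih =>
      by_cases hx : x = 1
      · rw [List.filter_cons_of_neg (by simpa using hx), ih, hx, List.prod_cons, one_mul]
      · rw [List.filter_cons_of_pos (by simpa using hx), List.prod_cons, List.prod_cons, ih]
  have hdown : downProd u N = (((List.range N).map u).reverse).prod := by
    induction N with
    | zero => rfl
    | succ N ih => simp [List.range_succ, downProd_succ, ih]
  have hpw : ((((List.range N).map u).reverse).filter (· ≠ 1)).Pairwise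
      fun u u' => u'.DominatedBy u :=
    List.Pairwise.filter _ (List.pairwise_reverse.2 (List.pairwise_map.2
      (List.pairwise_lt_range.imp fun {i j} hij => hlt i j hij)))
  have hmem : ∀ x ∈ ((((List.range N).map u).reverse).filter (· ≠ 1)), x.IsRow ∧ x ≠ 1 := by
    intro x hx
    obtain ⟨h1, h2⟩ := List.mem_filter.1 hx
    obtain ⟨i, -, rfl⟩ := List.mem_map.1 (List.mem_reverse.1 h1)
    exact ⟨hu i, by simpa using h2⟩
  refine ⟨_, ⟨(hprod _).trans hdown.symm, hmem, ?_⟩, hpw.isChain⟩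
  exact (hpw.imp_of_mem fun {x y} hx _ hxy => not_isRow_mul (hmem x hx).2 hxy).isChain

/-- The word is inserted into `n` empty rows; what leaves the last one has no letter of positive
duration. -/
theorem exists_isTableau_knuthCon (w : TimedWord n) : ∃ t, t.IsTableau ∧ knuthCon n t w := by
  obtain ⟨L, rfl⟩ := exists_spell w
  set W : List (ℕ × ℝ) := L.map fun x => ((x.1 : ℕ), (x.2 : ℝ)) with hWdef
  have hW : Valid n 0 W := by
    intro x hx
    obtain ⟨y, -, rfl⟩ := List.mem_map.1 hx
    exact ⟨y.2.2, y.1.2, fun h => absurd h (Nat.not_lt_zero _)⟩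
  have hWL : spellN n W = spell L := by
    rw [spellN, spell, hWdef, List.map_map]
    congr 1
    refine List.map_congr_left fun x _ => ?_
    simp [segN_of_lt x.1.2]
  have h0 : ∀ _ : ℕ, IsCum fun _ : ℕ => (0 : ℝ) := fun _ => ⟨rfl, fun _ _ _ => le_rfl⟩
  have key := knuthCon_downProd (n := n) (p := fun _ _ => 0) h0 hW n
  have hone : ∀ N, downProd (fun _ => row n fun _ => 0) N = (1 : TimedWord n) := by
    intro N
    have : row n (fun _ => 0) = (1 : TimedWord n) :=
      rowPart_eq_one (fun _ _ _ => le_rfl) (by omega) rfl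
    induction N with
    | zero => rfl
    | succ N ih => rw [downProd_succ, ih, this, one_mul]
  rw [hone, spellN_eq_one (valid_bumpSeq h0 hW n), one_mul, one_mul, hWL] at key
  have hc : ∀ i, IsCum (insWord (fun _ => 0) (bumpSeq n (fun _ _ => 0) W i)) := fun i =>
    (h0 i).insWord (valid_bumpSeq h0 hW i)
  refine ⟨_, isTableau_downProd (fun i => isRow_row (hc i)) (fun i => ?_) n,
    (knuthCon n).symm key⟩
  exact (dominatedBy_row_iff (hc i) (hc (i + 1))).2
    (insWord_bumpWord_le (h0 i) (valid_bumpSeq h0 hW i) fun _ _ => le_rfl)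

end TimedWord

theorem mainTheorem6 (n : ℕ) (C : TimedWord.Plactic n) :
    ∃! w : TimedWord n, w.IsTableau ∧ (w : TimedWord.Plactic n) = C := by
  obtain ⟨w, rfl⟩ := Con.mk'_surjective (c := TimedWord.knuthCon n) C
  obtain ⟨t, ht, htw⟩ := TimedWord.exists_isTableau_knuthCon w
  refine ⟨t, ⟨ht, (Con.eq _).2 htw⟩, fun t' h' => ?_⟩
  exact TimedWord.eq_of_isTableau_of_knuthCon h'.1 ht
    ((TimedWord.knuthCon n).trans ((Con.eq _).1 h'.2) ((TimedWord.knuthCon n).symm htw))
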